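/- Let $X_0,X_1,X_2,\dots$ be i.i.d. real random variables with $X_0$ sub-Gaussian (i.e. $\mathbb{E}\exp(X_0^2/K^2)\le 2$ for some $K>0$; no centring is assumed), let $\delta>0$, and let $Z_0,Z_1,\dots$ be i.i.d. $N(0,\delta^2)$ variables, independent of the $X_i$. Put $Y_i=X_i+Z_i$ and $S_n=Y_0+\dots+Y_{n-1}$, let $\mathbb{P}_Y,\mathbb{P}_{S_n}$ be the laws of $Y_0$ and $S_n$, and let $C_{(n)}:L^2(\mathbb{P}_Y)\to L^2(\mathbb{P}_{S_n})$ be the conditional expectation operator $(C_{(n)}f)(s)=\mathbb{E}[f(Y_0)\mid S_n=s]$, with adjoint $(C_{(n)}^*g)(y)=\mathbb{E}[g(S_n)\mid Y_0=y]$. Then for all sufficiently large $n$ the operator $C_{(n)}^*C_{(n)}$ is diagonalizable: $L^2(\mathbb{P}_Y)$ has an orthonormal basis $(f_k)_{k\ge 0}$ of eigenfunctions, $C_{(n)}^*C_{(n)}f_k=\lambda_k^{n,\delta}f_k$, with $\lambda_0^{n,\delta}\ge\lambda_1^{n,\delta}\ge\lambda_2^{n,\delta}\ge\cdots$. For any such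 eigenvalue sequences, $\sum_k\lambda_k^{n,\delta}<\infty$ for all large $n$, and $$\limsup_{n\to\infty} n\lambda_2^{n,\delta}\;\le\;\limsup_{n\to\infty} n\sum_{k=2}^\infty\lambda_k^{n,\delta}\;\le\;\frac{2\,\mathrm{Var}(X_0)}{\delta^2}.$$ Hence, writing $\Theta^{(n)}=\frac{1}{n\lambda_2^{n,\delta}}-1$, if $\delta^2>2\,\mathrm{Var}(X_0)$ then $\Theta^{(n)}>0$ for all sufficiently large $n$. -/

import Mathlib

open MeasureTheory ProbabilityTheory Filter Topology
open scoped ENNReal NNReal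

noncomputable section

/-- A real random variable `X` is sub-Gaussian if `𝔼 exp (X² / K²) ≤ 2` for some `K > 0`,
i.e. its `ψ₂` Orlicz norm is finite. No centring is required. -/
def IsSubGaussian {Ω : Type*} [MeasurableSpace Ω] (X : Ω → ℝ) (P : Measure Ω) : Prop :=
  ∃ K : ℝ, 0 < K ∧ ∫⁻ ω, ENNReal.ofReal (Real.exp (X ω ^ 2 / K ^ 2)) ∂P ≤ 2

/-- The regularized variables `Y i = X i + Z i`. -/
def regularized {Ω : Type*} (X Z : ℕ → Ω → ℝ) (i : ℕ) : Ω → ℝ :=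
  fun ω => X i ω + Z i ω

/-- The sum `S n = Y 0 + ⋯ + Y (n - 1)` of the first `n` variables. -/
def partialSum {Ω : Type*} (Y : ℕ → Ω → ℝ) (n : ℕ) : Ω → ℝ :=
  fun ω => ∑ i ∈ Finset.range n, Y i ω

theorem measurable_regularized {Ω : Type*} [MeasurableSpace Ω] {X Z : ℕ → Ω → ℝ}
    (hX : ∀ i, Measurable (X i)) (hZ : ∀ i, Measurable (Z i)) (i : ℕ) :
    Measurable (regularized X Z i) :=
  (hX i).add (hZ i)

theorem measurable_partialSum {Ω : Type*} [MeasurableSpace Ω] {Y : ℕ → Ω → ℝ}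
    (hY : ∀ i, Measurable (Y i)) (n : ℕ) : Measurable (partialSum Y n) := by
  unfold partialSum
  exact Finset.measurable_sum _ fun i _ => hY i

/-- The isometry `f ↦ f ∘ U` from `L²(ℙ_U)` into `L²(P)`, where `ℙ_U = P.map U` is the law of
`U`. -/
def pullbackL2 {Ω : Type*} [MeasurableSpace Ω] (P : Measure Ω) {U : Ω → ℝ}
    (hU : Measurable U) : Lp ℝ 2 (P.map U) →L[ℝ] Lp ℝ 2 P :=
  (Lp.compMeasurePreservingₗᵢ ℝ U
    (hU.measurePreserving P)).toContinuousLinearMap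

/-- The conditional expectation operator `L²(ℙ_U) → L²(ℙ_V)`, `(C f)(v) = 𝔼[f(U) | V = v]`.
It is the composition of `f ↦ f ∘ U` with the orthogonal projection of `L²(P)` onto the
functions of `V`, read as functions on the range of `V`. See `condExpOp_comp_ae_eq`. -/
def condExpOp {Ω : Type*} [MeasurableSpace Ω] (P : Measure Ω) {U V : Ω → ℝ}
    (hU : Measurable U) (hV : Measurable V) : Lp ℝ 2 (P.map U) →L[ℝ] Lp ℝ 2 (P.map V) :=
  (ContinuousLinearMap.adjoint (pullbackL2 P hV)).comp (pullbackL2 P hU)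

theorem pullbackL2_ae_eq {Ω : Type*} [MeasurableSpace Ω] (P : Measure Ω) {U : Ω → ℝ}
    (hU : Measurable U) (f : Lp ℝ 2 (P.map U)) :
    pullbackL2 P hU f =ᵐ[P] fun ω => f (U ω) :=
  Lp.coeFn_compMeasurePreserving f (hU.measurePreserving P)

/-- `condExpOp` is conditional expectation: `(C f)(V) = 𝔼[f(U) | V]` almost surely. -/
theorem condExpOp_comp_ae_eq {Ω : Type*} [MeasurableSpace Ω] (P : Measure Ω)
    [IsProbabilityMeasure P] {U V : Ω → ℝ} (hU : Measurable U) (hV : Measurable V)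
    (f : Lp ℝ 2 (P.map U)) :
    (fun ω => condExpOp P hU hV f (V ω)) =ᵐ[P]
      P[fun ω => f (U ω) | MeasurableSpace.comap V inferInstance] := by
  have : IsProbabilityMeasure (P.map U) := Measure.isProbabilityMeasure_map hU.aemeasurable
  have : IsProbabilityMeasure (P.map V) := Measure.isProbabilityMeasure_map hV.aemeasurable
  set g := condExpOp P hU hV f with hg
  have hfi : Integrable (fun ω => f (U ω)) P :=
    (hU.measurePreserving P).integrable_comp_of_integrable
      ((Lp.memLp f).integrable (by norm_num))
  have hgi : Integrable (fun ω => g (V ω)) P :=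
    (hV.measurePreserving P).integrable_comp_of_integrable
      ((Lp.memLp g).integrable (by norm_num))
  refine ae_eq_condExp_of_forall_setIntegral_eq hV.comap_le hfi
    (fun _ _ _ => hgi.integrableOn) ?_ ?_
  · rintro s ⟨B, hB, rfl⟩ -
    have hne : (P.map V) B ≠ ∞ := measure_ne_top _ _
    have h1 : ∫ ω in V ⁻¹' B, g (V ω) ∂P = ∫ v in B, g v ∂(P.map V) :=
      (setIntegral_map hB (Lp.aestronglyMeasurable g) hV.aemeasurable).symm
    have h2 := L2.inner_indicatorConstLp_one (𝕜 := ℝ) hB hne g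
    rw [h1, ← h2, hg, condExpOp, ContinuousLinearMap.comp_apply,
      ContinuousLinearMap.adjoint_inner_right, L2.inner_def,
      ← integral_indicator (hV hB)]
    refine integral_congr_ae ?_
    have h3 : (fun ω => indicatorConstLp 2 hB hne (1 : ℝ) (V ω)) =ᵐ[P]
        fun ω => B.indicator (fun _ => (1 : ℝ)) (V ω) :=
      (hV.measurePreserving P).quasiMeasurePreserving.ae_eq_comp
        (indicatorConstLp_coeFn (p := 2) (hs := hB) (hμs := hne) (c := (1 : ℝ)))
    filter_upwards [pullbackL2_ae_eq P hU f,
      pullbackL2_ae_eq P hV (indicatorConstLp 2 hB hne (1 : ℝ)), h3] with ω e1 e2 e3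
    rw [e1, e2, e3]
    by_cases hω : V ω ∈ B
    · simp [hω]
    · simp [hω]
  · exact ((Lp.stronglyMeasurable g).comp_measurable
      (comap_measurable V)).aestronglyMeasurable

/-- The adjoint of `f ↦ 𝔼[f(U) | V = ·]` is `g ↦ 𝔼[g(V) | U = ·]`. -/
theorem adjoint_condExpOp {Ω : Type*} [MeasurableSpace Ω] (P : Measure Ω)
    {U V : Ω → ℝ} (hU : Measurable U) (hV : Measurable V) :
    ContinuousLinearMap.adjoint (condExpOp P hU hV) = condExpOp P hV hU := by
  simp [condExpOp, ContinuousLinearMap.adjoint_comp]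

/-- The self-adjoint operator `C* C` on `L²(ℙ_U)`, where `(C f)(v) = 𝔼[f(U) | V = v]`. -/
def condExpGram {Ω : Type*} [MeasurableSpace Ω] (P : Measure Ω) {U V : Ω → ℝ}
    (hU : Measurable U) (hV : Measurable V) : Lp ℝ 2 (P.map U) →L[ℝ] Lp ℝ 2 (P.map U) :=
  (ContinuousLinearMap.adjoint (condExpOp P hU hV)).comp (condExpOp P hU hV)

/-- `lam 0 ≥ lam 1 ≥ ⋯` is the sequence of eigenvalues of `T`, listed with multiplicity:
there is an orthonormal (Hilbert) basis `b` of the space with `T (b k) = lam k • b k`. -/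
def IsEigenvalueSeq {H : Type*} [NormedAddCommGroup H] [InnerProductSpace ℝ H]
    (T : H →L[ℝ] H) (lam : ℕ → ℝ) : Prop :=
  Antitone lam ∧ ∃ b : HilbertBasis ℕ ℝ H, ∀ k, T (b k) = lam k • b k

/-- `Θ⁽ⁿ⁾ = 1 / (n λ₂) - 1`, for the eigenvalue sequence `lam` of `C₍ₙ₎* C₍ₙ₎`. -/
def theta (n : ℕ) (lam : ℕ → ℝ) : ℝ := 1 / (n * lam 2) - 1

end

/-!
Let `C : L²(ℙ_Y) → L²(ℙ_S)` be the conditional expectation operator for `S = S n`. The theorem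
follows from the two-sided control of the trace of `C* C` to order `1 / n`.

*Upper bound for the trace.* Put `T = X 1 + ⋯ + X (n - 1)`. Given `Y 0 = y` and `T = t`, the sum `S`
is `N(y + t, (n - 1) δ²)`, with density `a`; for an independent copy `x` of `X 0`, the mixture over
`(x, t)` of the densities `b` of `N(x + t, n δ²)` is the density of `S`. For an orthonormal family
`(fᵢ)`, the function `G(y, s) = ∑ fᵢ(y) (C fᵢ)(s)` satisfies
`E G(Y 0, S) = ∑ ‖C fᵢ‖² = ∬ G² dℙ_Y dℙ_S`. Integrating `2 G a ≤ G² b + a² / b`, in which `a² / b`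
is an explicit multiple of a Gaussian density, gives
`∑ ‖C fᵢ‖² ≤ n / √(n² - 1) · E exp ((Y 0 - x)² / ((n + 1) δ²))`
(`hilbertSchmidtLE_condExpOp`, `NoisyWalk.two_mul_lintegral_le`). Sub-Gaussianity makes the moment
generating function of `(Y 0 - x)²` differentiable at `0`, and `E (Y 0 - x)² = 2 Var (X 0) + δ²`, so
the right side is `1 + (1 + 2 Var (X 0) / δ²) / n + o(1 / n)` (`NoisyWalk.tendsto_hsBound`).

*Lower bound for the two leading eigenvalues.* The constant function and the standardization of
`Y 0` are orthonormal, and `‖C f‖²` is at least `1` on the first and at least the squared correlation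
`1 / n` of `Y 0` and `S` on the second, so `λ₀ + λ₁ ≥ 1 + 1 / n` by Ky Fan's inequality
(`IsEigenvalueSeq.norm_sq_add_norm_sq_le`). Subtracting leaves `2 Var (X 0) / (n δ²) + o(1 / n)`
for `∑_{k ≥ 2} λ_k`.

*Diagonalization.* The trace bound makes `C` compact and leaves only finitely many eigenvalues above
any positive level. The eigenvectors can be listed along `ℕ` by decreasing eigenvalue because
`L²(ℙ_Y)` is infinite-dimensional and `C` is injective (`HilbertSchmidtLE.exists_isEigenvalueSeq`);
injectivity comes from testing `C f` against `exp (t S)` and the uniqueness of the two-sided Laplace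
transform (`NoisyWalk.injective_condExpOp`). It also makes every eigenvalue positive, so that `Θ` is
not affected by the convention `1 / 0 = 0`.
-/

/-! ### Operators with a bounded Hilbert–Schmidt sum -/

/-- `C` is Hilbert–Schmidt with squared norm at most `M`: the sum of `‖C x‖²` over any finite
orthonormal set is at most `M`. -/
def HilbertSchmidtLE {H K : Type*} [NormedAddCommGroup H] [InnerProductSpace ℝ H]
    [NormedAddCommGroup K] [InnerProductSpace ℝ K] (C : H →L[ℝ] K) (M : ℝ) : Prop :=
  ∀ s : Finset H, Orthonormal ℝ ((↑) : s → H) → ∑ x ∈ s, ‖C x‖ ^ 2 ≤ M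

section Hilbert

variable {H K : Type*} [NormedAddCommGroup H] [InnerProductSpace ℝ H]
  [NormedAddCommGroup K] [InnerProductSpace ℝ K]

theorem HilbertSchmidtLE.sum_le {C : H →L[ℝ] K} {M : ℝ} (hC : HilbertSchmidtLE C M)
    {ι : Type*} {b : ι → H} (hb : Orthonormal ℝ b) (F : Finset ι) :
    ∑ i ∈ F, ‖C (b i)‖ ^ 2 ≤ M := by
  classical
  have hinj : Function.Injective b := hb.linearIndependent.injective
  have h := hC (F.image b) ?_
  · rwa [Finset.sum_image fun x _ y _ hxy => hinj hxy] at h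
  · refine hb.toSubtypeRange.comp (fun x : F.image b => ⟨x.1, ?_⟩) ?_
    · obtain ⟨i, -, hi⟩ := Finset.mem_image.1 x.2
      exact ⟨i, hi⟩
    · intro x y hxy
      exact Subtype.ext (Subtype.mk.inj hxy)

/-- A Hilbert–Schmidt operator is compact: on the orthogonal complement of the span of a finite
orthonormal set that nearly maximizes `∑ ‖C x‖²`, the operator has small norm. -/
theorem HilbertSchmidtLE.isCompactOperator [CompleteSpace K] {C : H →L[ℝ] K} {M : ℝ}
    (hC : HilbertSchmidtLE C M) : IsCompactOperator C := by
  classical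
  set S : Set ℝ := {r | ∃ s : Finset H, Orthonormal ℝ ((↑) : s → H) ∧ r = ∑ x ∈ s, ‖C x‖ ^ 2}
  have hbdd : BddAbove S := ⟨M, by rintro _ ⟨s, hs, rfl⟩; exact hC s hs⟩
  have hne : S.Nonempty := ⟨0, ∅, by simp [Orthonormal], by simp⟩
  suffices h : C ∈ closure {f : H →L[ℝ] K | IsCompactOperator f} by
    rwa [(isClosed_setOfPred_isCompactOperator (σ₁₂ := RingHom.id ℝ)).closure_eq] at h
  refine Metric.mem_closure_iff.2 fun ε hε => ?_
  obtain ⟨_, ⟨s, hs, rfl⟩, hlt⟩ := exists_lt_of_lt_csSup hne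
    (show sSup S - (ε / 2) ^ 2 < sSup S by have := sq_pos_of_pos (half_pos hε); linarith)
  set V : Submodule ℝ H := Submodule.span ℝ (s : Set H)
  have : FiniteDimensional ℝ V := FiniteDimensional.span_finset ℝ s
  have hsmall : ∀ u ∈ Vᗮ, ‖u‖ = 1 → ‖C u‖ ≤ ε / 2 := by
    intro u hu hu1
    have horth : ∀ x ∈ s, inner ℝ x u = 0 := fun x hx =>
      (Submodule.mem_orthogonal V u).1 hu x (Submodule.subset_span hx)
    have hus : u ∉ s := fun h => by
      have := horth u h
      rw [real_inner_self_eq_norm_sq, hu1] at this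
      norm_num at this
    have hs' : Orthonormal ℝ ((↑) : ↥(insert u s) → H) := by
      have hs1 := (orthonormal_subtype_iff_ite (s := (s : Set H))).1 hs
      refine (orthonormal_subtype_iff_ite (s := ((insert u s : Finset H) : Set H))).2 ?_
      intro x hx y hy
      rw [Finset.mem_coe] at hx hy
      rcases Finset.mem_insert.1 hx with rfl | hx' <;>
        rcases Finset.mem_insert.1 hy with rfl | hy'
      · simp [hu1]
      · rw [if_neg (by rintro rfl; exact hus hy'), real_inner_comm]
        exact horth y hy'
      · rw [if_neg (by rintro rfl; exact hus hx')]
        exact horth x hx'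
      · exact hs1 x hx' y hy'
    have h1 := le_csSup hbdd ⟨insert u s, hs', rfl⟩
    rw [Finset.sum_insert hus] at h1
    exact (sq_le_sq₀ (norm_nonneg _) (by positivity)).1 (by linarith)
  refine ⟨C.comp V.starProjection, ?_, ?_⟩
  · have : LocallyCompactSpace V := by
      have := FiniteDimensional.proper ℝ V
      infer_instance
    have h := (isCompactOperator_of_locallyCompactSpace_rng (C.comp V.subtypeL)).comp_clm
      V.orthogonalProjectionOnto
    exact h
  · rw [dist_eq_norm]
    refine lt_of_le_of_lt (ContinuousLinearMap.opNorm_le_bound _ (half_pos hε).le fun x => ?_)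
      (half_lt_self hε)
    have hx : (C - C.comp V.starProjection) x = C (Vᗮ.starProjection x) := by
      rw [Submodule.starProjection_orthogonal_val]
      simp
    rw [hx]
    set y := Vᗮ.starProjection x
    have hyV : y ∈ Vᗮ := Submodule.starProjection_apply_mem _ _
    have hyx : ‖y‖ ≤ ‖x‖ := Submodule.norm_starProjection_apply_le _ _
    rcases eq_or_ne y 0 with h0 | h0
    · rw [h0]; simp; positivity
    · have h2 := hsmall (‖y‖⁻¹ • y) (Vᗮ.smul_mem _ hyV) (by
        rw [norm_smul, norm_inv, norm_norm, inv_mul_cancel₀ (norm_ne_zero_iff.2 h0)])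
      rw [map_smul, norm_smul, norm_inv, norm_norm] at h2
      have h3 : 0 < ‖y‖ := norm_pos_iff.2 h0
      calc ‖C y‖ = ‖y‖ * (‖y‖⁻¹ * ‖C y‖) := by field_simp
        _ ≤ ‖y‖ * (ε / 2) := by gcongr
        _ ≤ ε / 2 * ‖x‖ := by rw [mul_comm]; gcongr

/-! ### Enumerating eigenvectors by decreasing eigenvalue -/

/-- An infinite family of positive numbers with finite superlevel sets can be listed in
nonincreasing order along `ℕ`. -/
theorem exists_equiv_antitone {ι : Type*} [Infinite ι] (f : ι → ℝ) (hf : ∀ i, 0 < f i)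
    (hfin : ∀ ε > 0, {i | ε ≤ f i}.Finite) : ∃ e : ℕ ≃ ι, Antitone (f ∘ e) := by
  classical
  have hcount : Countable ι := by
    rw [← Set.countable_univ_iff]
    refine (Set.countable_iUnion fun n : ℕ =>
      (hfin (1 / ((n : ℝ) + 1)) (by positivity)).countable).mono fun i _ => ?_
    obtain ⟨n, hn⟩ := exists_nat_one_div_lt (hf i)
    exact Set.mem_iUnion.2 ⟨n, hn.le⟩
  obtain ⟨g, hg⟩ := Countable.exists_injective_nat ι
  -- `A i` is the set of indices that have to be listed before `i`; ties are broken by `g`.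
  set A : ι → Set ι := fun i => {j | f i < f j ∨ (f i = f j ∧ g j < g i)}
  have hAfin : ∀ i, (A i).Finite := fun i => (hfin (f i) (hf i)).subset (by
    rintro j (h | h)
    · exact h.le
    · exact h.1.le)
  have hlt : ∀ i j, j ∈ A i → (A j).ncard < (A i).ncard := by
    intro i j hj
    refine Set.ncard_lt_ncard ⟨?_, ?_⟩ (hAfin i)
    · rintro k (hk | hk) <;> rcases hj with hj | hj
      · exact Or.inl (hj.trans hk)
      · exact Or.inl (hj.1.trans_lt hk)
      · exact Or.inl (hj.trans_eq hk.1)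
      · exact Or.inr ⟨hj.1.trans hk.1, hk.2.trans hj.2⟩
    · intro h
      rcases h hj with h | h
      · exact h.false
      · exact h.2.false
  set r : ι → ℕ := fun i => (A i).ncard
  have hrinj : Function.Injective r := by
    intro i j hij
    by_contra hne
    rcases lt_trichotomy (f i) (f j) with h | h | h
    · exact (hlt i j (Or.inl h)).ne hij.symm
    · rcases lt_or_gt_of_ne (hg.ne hne) with h' | h'
      · exact (hlt j i (Or.inr ⟨h.symm, h'⟩)).ne hij
      · exact (hlt i j (Or.inr ⟨h, h'⟩)).ne hij.symm
    · exact (hlt j i (Or.inl h)).ne hij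
  have : Infinite (Set.range r) := (Set.infinite_range_of_injective hrinj).to_subtype
  let e : ℕ ≃ ι :=
    (Nat.Subtype.orderIsoOfNat (Set.range r)).toEquiv.trans (Equiv.ofInjective r hrinj).symm
  have he : ∀ k, r (e k) = (Nat.Subtype.orderIsoOfNat (Set.range r) k : ℕ) := fun k =>
    Equiv.apply_ofInjective_symm hrinj _
  refine ⟨e, fun k l hkl => ?_⟩
  by_contra! hcon
  have h1 := hlt (e k) (e l) (Or.inl hcon)
  have h2 : r (e k) ≤ r (e l) := by
    rw [he, he]
    exact (Nat.Subtype.orderIsoOfNat (Set.range r)).monotone hkl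
  exact absurd h1 (not_lt.2 h2)

variable [CompleteSpace H] [CompleteSpace K]

theorem inner_adjoint_comp_self (C : H →L[ℝ] K) (x y : H) :
    inner ℝ (((ContinuousLinearMap.adjoint C).comp C) x) y = inner ℝ (C x) (C y) := by
  rw [ContinuousLinearMap.comp_apply, ContinuousLinearMap.adjoint_inner_left]

theorem isSymmetric_adjoint_comp_self (C : H →L[ℝ] K) :
    ((ContinuousLinearMap.adjoint C).comp C).IsSymmetric := by
  intro x y
  change inner ℝ (((ContinuousLinearMap.adjoint C).comp C) x) y =
    inner ℝ x (((ContinuousLinearMap.adjoint C).comp C) y)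
  rw [inner_adjoint_comp_self, real_inner_comm, ← inner_adjoint_comp_self, real_inner_comm]

theorem norm_sq_of_adjoint_comp_self_eq_smul (C : H →L[ℝ] K) {x : H} {c : ℝ}
    (hx : ((ContinuousLinearMap.adjoint C).comp C) x = c • x) (hx1 : ‖x‖ = 1) :
    ‖C x‖ ^ 2 = c := by
  rw [← real_inner_self_eq_norm_sq, ← inner_adjoint_comp_self, hx, real_inner_smul_left,
    real_inner_self_eq_norm_sq, hx1]
  simp

/-- If `C` is Hilbert–Schmidt and injective on an infinite-dimensional space, then `C* C` has an
orthonormal basis of eigenvectors with nonincreasing eigenvalues. Injectivity is essential: with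
infinitely many positive eigenvalues, an eigenvalue `0` has no place in a list indexed by `ℕ`. -/
theorem HilbertSchmidtLE.exists_isEigenvalueSeq {C : H →L[ℝ] K} {M : ℝ}
    (hC : HilbertSchmidtLE C M) (hinj : Function.Injective C) (hdim : ¬ FiniteDimensional ℝ H) :
    ∃ lam : ℕ → ℝ, IsEigenvalueSeq ((ContinuousLinearMap.adjoint C).comp C) lam := by
  set T := (ContinuousLinearMap.adjoint C).comp C
  have hsymm : T.IsSymmetric := isSymmetric_adjoint_comp_self C
  have hcomp : IsCompactOperator T := hC.isCompactOperator.clm_comp (ContinuousLinearMap.adjoint C)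
  have hbot := ContinuousLinearMap.orthogonalComplement_iSup_eigenspaces_eq_bot hcomp hsymm
  let E : ℝ → Submodule ℝ H := fun μ => Module.End.eigenspace (T : Module.End ℝ H) μ
  have hEcl : ∀ μ, IsClosed (E μ : Set H) := by
    intro μ
    have : (E μ : Set H) = {x | T x = μ • x} := by
      ext x; exact Module.End.mem_eigenspace_iff
    rw [this]
    exact isClosed_eq T.continuous (continuous_const_smul μ)
  have hEc : ∀ μ, CompleteSpace (E μ) := fun μ => (hEcl μ).completeSpace_coe
  choose w v _ using fun μ => exists_hilbertBasis ℝ (E μ)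
  let b : (Σ μ, w μ) → H := fun a => (E a.1).subtypeₗᵢ (v a.1 a.2)
  have hbo : Orthonormal ℝ b :=
    (hsymm.orthogonalFamily_eigenspaces).orthonormal_sigma_orthonormal fun μ => (v μ).orthonormal
  have hbT : ∀ a, T (b a) = a.1 • b a := fun a =>
    Module.End.mem_eigenspace_iff.1 (v a.1 a.2).2
  have hbnorm : ∀ a, ‖C (b a)‖ ^ 2 = a.1 := fun a =>
    norm_sq_of_adjoint_comp_self_eq_smul C (hbT a) (hbo.1 a)
  have hspan : (Submodule.span ℝ (Set.range b))ᗮ = ⊥ := by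
    rw [eq_bot_iff, ← hbot]
    intro x hx
    rw [Submodule.mem_orthogonal]
    have key : ∀ μ, ∀ u ∈ E μ, inner ℝ u x = 0 := by
      intro μ u hu
      have h1 : ∀ i : w μ, inner ℝ ((v μ i : E μ) : H) x = 0 := fun i =>
        (Submodule.mem_orthogonal _ _).1 hx _ (Submodule.subset_span ⟨⟨μ, i⟩, rfl⟩)
      -- the functional `u ↦ ⟪u, x⟫` on the eigenspace kills a basis
      have h2 := ((v μ).hasSum_repr ⟨u, hu⟩).mapL ((innerSL ℝ x).comp (E μ).subtypeL)
      have h3 : ∀ i, ((innerSL ℝ x).comp (E μ).subtypeL) ((v μ).repr ⟨u, hu⟩ i • v μ i) = 0 := by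
        intro i
        rw [map_smul]
        simp only [ContinuousLinearMap.comp_apply, Submodule.subtypeL_apply, innerSL_apply_apply]
        rw [real_inner_comm, h1 i, smul_zero]
      simp only [h3] at h2
      have h4 := h2.unique hasSum_zero
      simp only [ContinuousLinearMap.comp_apply, Submodule.subtypeL_apply,
        innerSL_apply_apply] at h4
      rw [real_inner_comm]
      exact h4
    intro u hu
    induction hu using Submodule.iSup_induction' with
    | mem μ u hu => exact key μ u hu
    | zero => simp
    | add u u' _ _ h h' => rw [inner_add_left, h, h', add_zero]
  have hpos : ∀ a : (Σ μ, w μ), 0 < a.1 := by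
    intro a
    rw [← hbnorm a]
    have h0 : b a ≠ 0 := hbo.ne_zero a
    have : C (b a) ≠ 0 := fun h => h0 (hinj (by rw [h, map_zero]))
    positivity
  have hinf : Infinite (Σ μ, w μ) := by
    by_contra hfin
    rw [not_infinite_iff_finite] at hfin
    refine hdim ?_
    have := Fintype.ofFinite (Σ μ, w μ)
    have hfd : FiniteDimensional ℝ (Submodule.span ℝ (Set.range b)) :=
      FiniteDimensional.span_of_finite ℝ (Set.finite_range b)
    have htop : Submodule.span ℝ (Set.range b) = ⊤ := (Submodule.orthogonal_eq_bot_iff).1 hspan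
    rw [htop] at hfd
    exact Module.Finite.equiv Submodule.topEquiv
  have hfin : ∀ ε > 0, {a : (Σ μ, w μ) | ε ≤ a.1}.Finite := by
    intro ε hε
    by_contra hcon
    obtain ⟨N, hN⟩ := exists_nat_gt (M / ε)
    obtain ⟨F, hF, hFc⟩ := Set.Infinite.exists_subset_card_eq hcon N
    have h1 := hC.sum_le hbo F
    have h2 : (N : ℝ) * ε ≤ ∑ a ∈ F, ‖C (b a)‖ ^ 2 := by
      rw [← hFc, ← nsmul_eq_mul]
      refine Finset.card_nsmul_le_sum _ _ _ fun a ha => ?_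
      rw [hbnorm a]
      exact hF ha
    rw [div_lt_iff₀ hε] at hN
    linarith
  obtain ⟨e, he⟩ := exists_equiv_antitone (fun a : (Σ μ, w μ) => a.1) hpos hfin
  refine ⟨fun k => (e k).1, he, HilbertBasis.mkOfOrthogonalEqBot (hbo.comp e e.injective)
    (by rwa [EquivLike.range_comp]), fun k => ?_⟩
  rw [HilbertBasis.coe_mkOfOrthogonalEqBot]
  exact hbT (e k)

/-! ### Inequalities for an ordered eigenvalue sequence -/

section EigenvalueSeq

variable {C : H →L[ℝ] K} {lam : ℕ → ℝ}

theorem IsEigenvalueSeq.nonneg (h : IsEigenvalueSeq ((ContinuousLinearMap.adjoint C).comp C) lam)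
    (k : ℕ) : 0 ≤ lam k := by
  obtain ⟨-, b, hb⟩ := h
  rw [← norm_sq_of_adjoint_comp_self_eq_smul C (hb k) (b.orthonormal.1 k)]
  positivity

theorem IsEigenvalueSeq.pos (h : IsEigenvalueSeq ((ContinuousLinearMap.adjoint C).comp C) lam)
    (hinj : Function.Injective C) (k : ℕ) : 0 < lam k := by
  obtain ⟨-, b, hb⟩ := h
  rw [← norm_sq_of_adjoint_comp_self_eq_smul C (hb k) (b.orthonormal.1 k)]
  have h0 : b k ≠ 0 := b.orthonormal.ne_zero k
  have : C (b k) ≠ 0 := fun h => h0 (hinj (by rw [h, map_zero]))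
  positivity

theorem IsEigenvalueSeq.sum_le (h : IsEigenvalueSeq ((ContinuousLinearMap.adjoint C).comp C) lam)
    {M : ℝ} (hC : HilbertSchmidtLE C M) (F : Finset ℕ) : ∑ k ∈ F, lam k ≤ M := by
  obtain ⟨-, b, hb⟩ := h
  refine le_trans (le_of_eq ?_) (hC.sum_le b.orthonormal F)
  exact Finset.sum_congr rfl fun k _ =>
    (norm_sq_of_adjoint_comp_self_eq_smul C (hb k) (b.orthonormal.1 k)).symm

theorem IsEigenvalueSeq.summable
    (h : IsEigenvalueSeq ((ContinuousLinearMap.adjoint C).comp C) lam)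
    {M : ℝ} (hC : HilbertSchmidtLE C M) : Summable lam :=
  summable_of_sum_le h.nonneg (h.sum_le hC)

/-- Ky Fan's inequality for two vectors. -/
theorem IsEigenvalueSeq.norm_sq_add_norm_sq_le
    (h : IsEigenvalueSeq ((ContinuousLinearMap.adjoint C).comp C) lam)
    {u v : H} (hu : ‖u‖ = 1) (hv : ‖v‖ = 1) (huv : inner ℝ u v = 0) :
    ‖C u‖ ^ 2 + ‖C v‖ ^ 2 ≤ lam 0 + lam 1 := by
  have hnn := h.nonneg
  obtain ⟨hanti, b, hb⟩ := h
  have hsymm := isSymmetric_adjoint_comp_self C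
  have hexp : ∀ x : H, HasSum (fun k => lam k * inner ℝ (b k) x ^ 2) (‖C x‖ ^ 2) := by
    intro x
    have h1 := b.hasSum_inner_mul_inner (((ContinuousLinearMap.adjoint C).comp C) x) x
    rw [inner_adjoint_comp_self, real_inner_self_eq_norm_sq] at h1
    refine Eq.subst (motive := fun f => HasSum f _) (funext fun k => ?_) h1
    have h2 : inner ℝ (((ContinuousLinearMap.adjoint C).comp C) x) (b k) =
        lam k * inner ℝ (b k) x := by
      have h3 : inner ℝ (((ContinuousLinearMap.adjoint C).comp C) x) (b k) =
        inner ℝ x (((ContinuousLinearMap.adjoint C).comp C) (b k)) := hsymm x (b k)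
      rw [h3, hb k, real_inner_smul_right, real_inner_comm]
    rw [h2]; ring
  have hnorm : ∀ x : H, ‖x‖ = 1 → HasSum (fun k => inner ℝ (b k) x ^ 2) 1 := by
    intro x hx
    have h1 := b.hasSum_inner_mul_inner x x
    rw [real_inner_self_eq_norm_sq, hx, one_pow] at h1
    refine Eq.subst (motive := fun f => HasSum f _) (funext fun k => ?_) h1
    rw [real_inner_comm x (b k)]; ring
  -- Bessel's inequality for `b k` against the pair `u, v`
  have hw : ∀ k, inner ℝ (b k) u ^ 2 + inner ℝ (b k) v ^ 2 ≤ 1 := by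
    intro k
    set p := inner ℝ (b k) u
    set q := inner ℝ (b k) v
    have h1 : 0 ≤ ‖b k - p • u - q • v‖ ^ 2 := by positivity
    have h2 : ‖b k - p • u - q • v‖ ^ 2 = 1 - p ^ 2 - q ^ 2 := by
      rw [norm_sub_sq_real, norm_sub_sq_real, inner_sub_left, real_inner_smul_right,
        real_inner_smul_right, real_inner_smul_right, real_inner_smul_left, huv, norm_smul,
        norm_smul, hu, hv, b.orthonormal.1 k, mul_one, mul_one, Real.norm_eq_abs,
        Real.norm_eq_abs, sq_abs, sq_abs]
      ring
    linarith
  have hsum := ((hexp u).add (hexp v)).sub (((hnorm u hu).add (hnorm v hv)).mul_left (lam 1))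
  have hle : ∀ k, lam k * inner ℝ (b k) u ^ 2 + lam k * inner ℝ (b k) v ^ 2 -
      lam 1 * (inner ℝ (b k) u ^ 2 + inner ℝ (b k) v ^ 2) ≤ if k = 0 then lam 0 - lam 1 else 0 := by
    intro k
    have hk : lam k * inner ℝ (b k) u ^ 2 + lam k * inner ℝ (b k) v ^ 2 -
      lam 1 * (inner ℝ (b k) u ^ 2 + inner ℝ (b k) v ^ 2) =
      (lam k - lam 1) * (inner ℝ (b k) u ^ 2 + inner ℝ (b k) v ^ 2) := by ring
    rw [hk]
    split_ifs with h0
    · subst h0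
      exact mul_le_of_le_one_right (sub_nonneg.2 (hanti zero_le_one)) (hw 0)
    · exact mul_nonpos_of_nonpos_of_nonneg
        (sub_nonpos.2 (hanti (Nat.one_le_iff_ne_zero.2 h0))) (by positivity)
  have h3 := hasSum_le hle hsum (hasSum_ite_eq 0 (lam 0 - lam 1))
  linarith

/-- Trace bound for the tail of the spectrum: what the Hilbert–Schmidt bound leaves after the
contribution of two orthonormal test vectors. -/
theorem IsEigenvalueSeq.tsum_tail_le
    (h : IsEigenvalueSeq ((ContinuousLinearMap.adjoint C).comp C) lam)
    {M : ℝ} (hC : HilbertSchmidtLE C M)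
    {u v : H} (hu : ‖u‖ = 1) (hv : ‖v‖ = 1) (huv : inner ℝ u v = 0) :
    ∑' k, lam (k + 2) ≤ M - (‖C u‖ ^ 2 + ‖C v‖ ^ 2) := by
  have hs := h.summable hC
  have h1 := hs.sum_add_tsum_nat_add 2
  have h2 : ∑' k, lam k ≤ M := hs.tsum_le_of_sum_le (h.sum_le hC)
  have h3 := h.norm_sq_add_norm_sq_le hu hv huv
  rw [Finset.sum_range_succ, Finset.sum_range_one] at h1
  linarith

end EigenvalueSeq

end Hilbert

/-! ### The conditional expectation operator as a bilinear form -/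

section CondExp

variable {Ω : Type*} [MeasurableSpace Ω] {P : Measure Ω} {U V : Ω → ℝ}

theorem inner_condExpOp (hU : Measurable U) (hV : Measurable V)
    (f : Lp ℝ 2 (P.map U)) (g : Lp ℝ 2 (P.map V)) :
    inner ℝ (condExpOp P hU hV f) g = ∫ ω, f (U ω) * g (V ω) ∂P := by
  rw [condExpOp, ContinuousLinearMap.comp_apply, ContinuousLinearMap.adjoint_inner_left,
    L2.inner_def]
  refine integral_congr_ae ?_
  filter_upwards [pullbackL2_ae_eq P hU f, pullbackL2_ae_eq P hV g] with ω h1 h2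
  rw [h1, h2]
  simp [mul_comm]

theorem integrable_comp_mul_comp (hU : Measurable U) (hV : Measurable V)
    (f : Lp ℝ 2 (P.map U)) (g : Lp ℝ 2 (P.map V)) :
    Integrable (fun ω => f (U ω) * g (V ω)) P :=
  ((Lp.memLp f).comp_measurePreserving (hU.measurePreserving P)).integrable_mul
    ((Lp.memLp g).comp_measurePreserving (hV.measurePreserving P))

/-- Lower bound for `‖C f‖` from a test function of unit norm. -/
theorem sq_integral_le_norm_sq_condExpOp (hU : Measurable U) (hV : Measurable V)
    (f : Lp ℝ 2 (P.map U)) (g : Lp ℝ 2 (P.map V)) (hg : ‖g‖ = 1) :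
    (∫ ω, f (U ω) * g (V ω) ∂P) ^ 2 ≤ ‖condExpOp P hU hV f‖ ^ 2 := by
  rw [← inner_condExpOp hU hV]
  refine sq_le_sq' ?_ ?_
  · have := neg_le_of_abs_le (abs_real_inner_le_norm (condExpOp P hU hV f) g)
    rwa [hg, mul_one] at this
  · have := real_inner_le_norm (condExpOp P hU hV f) g
    rwa [hg, mul_one] at this

/-- A Hilbert–Schmidt bound from a comparison of `E G(U, V)` with the second moment of `G` under
the product of the marginals. It is applied to `G = ∑ x ⊗ C x`, for which both quantities equal
`∑ ‖C x‖²`. -/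
theorem hilbertSchmidtLE_condExpOp [IsProbabilityMeasure P] (hU : Measurable U) (hV : Measurable V)
    {M : ℝ≥0∞} (hM : M ≠ ∞)
    (h : ∀ G : ℝ × ℝ → ℝ≥0∞, Measurable G →
      2 * ∫⁻ ω, G (U ω, V ω) ∂P ≤ ∫⁻ z, G z ^ 2 ∂((P.map U).prod (P.map V)) + M) :
    HilbertSchmidtLE (condExpOp P hU hV) M.toReal := by
  have : IsProbabilityMeasure (P.map U) := Measure.isProbabilityMeasure_map hU.aemeasurable
  have : IsProbabilityMeasure (P.map V) := Measure.isProbabilityMeasure_map hV.aemeasurable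
  classical
  intro s hs
  set C := condExpOp P hU hV with hC
  set A := ∑ x ∈ s, ‖C x‖ ^ 2
  set G : ℝ × ℝ → ℝ := fun z => ∑ x ∈ s, x z.1 * (C x) z.2 with hG
  have hGm : Measurable G := Finset.measurable_sum _ fun x _ =>
    ((Lp.stronglyMeasurable x).measurable.comp measurable_fst).mul
      ((Lp.stronglyMeasurable (C x)).measurable.comp measurable_snd)
  have h1 : ∫ ω, G (U ω, V ω) ∂P = A := by
    rw [hG, integral_finsetSum _ fun x _ => integrable_comp_mul_comp hU hV x (C x)]
    refine Finset.sum_congr rfl fun x _ => ?_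
    rw [← inner_condExpOp hU hV, ← hC, real_inner_self_eq_norm_sq]
  have hGsq : ∀ z, G z ^ 2 = ∑ x ∈ s, ∑ y ∈ s, (x z.1 * y z.1) * ((C x) z.2 * (C y) z.2) := by
    intro z
    rw [sq, hG, Finset.sum_mul_sum]
    refine Finset.sum_congr rfl fun x _ => Finset.sum_congr rfl fun y _ => ?_
    ring
  have hint : ∀ x y : Lp ℝ 2 (P.map U), Integrable
      (fun z : ℝ × ℝ => (x z.1 * y z.1) * ((C x) z.2 * (C y) z.2)) ((P.map U).prod (P.map V)) :=
    fun x y => ((Lp.memLp x).integrable_mul (Lp.memLp y)).mul_prod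
      ((Lp.memLp (C x)).integrable_mul (Lp.memLp (C y)))
  have hint2 : Integrable (fun z => G z ^ 2) ((P.map U).prod (P.map V)) := by
    simp only [hGsq]
    exact integrable_finsetSum _ fun x _ => integrable_finsetSum _ fun y _ => hint x y
  have horth := (orthonormal_subtype_iff_ite (s := (s : Set (Lp ℝ 2 (P.map U))))).1 hs
  have h2 : ∫ z, G z ^ 2 ∂((P.map U).prod (P.map V)) = A := by
    simp only [hGsq]
    rw [integral_finsetSum _ fun x _ => integrable_finsetSum _ fun y _ => hint x y]
    refine Finset.sum_congr rfl fun x hx => ?_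
    rw [integral_finsetSum _ fun y _ => hint x y]
    have h3 : ∀ y ∈ s, ∫ z : ℝ × ℝ, (x z.1 * y z.1) * ((C x) z.2 * (C y) z.2)
        ∂((P.map U).prod (P.map V)) = if y = x then ‖C x‖ ^ 2 else 0 := by
      intro y hy
      rw [integral_prod_mul (fun u => x u * y u) (fun v => (C x) v * (C y) v)]
      have e1 : ∫ u, x u * y u ∂(P.map U) = inner ℝ y x := by
        rw [L2.inner_def]
        exact integral_congr_ae (Eventually.of_forall fun u => by simp)
      have e2 : ∫ v, (C x) v * (C y) v ∂(P.map V) = inner ℝ (C y) (C x) := by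
        rw [L2.inner_def]
        exact integral_congr_ae (Eventually.of_forall fun u => by simp)
      rw [e1, e2, horth y hy x hx]
      split_ifs with hyx
      · rw [hyx, real_inner_self_eq_norm_sq, one_mul]
      · rw [zero_mul]
    rw [Finset.sum_congr rfl h3, Finset.sum_ite_eq', if_pos hx]
  have h4 := h (fun z => ENNReal.ofReal |G z|) (by fun_prop)
  have h5 : ENNReal.ofReal A ≤ ∫⁻ ω, ENNReal.ofReal |G (U ω, V ω)| ∂P := by
    rw [← h1]
    refine (ENNReal.ofReal_le_ofReal (le_abs_self _)).trans ?_
    have := enorm_integral_le_lintegral_enorm (μ := P) fun ω => G (U ω, V ω)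
    simpa only [Real.enorm_eq_ofReal_abs] using this
  have h6 : ∫⁻ z, (ENNReal.ofReal |G z|) ^ 2 ∂((P.map U).prod (P.map V)) = ENNReal.ofReal A := by
    rw [← h2, ofReal_integral_eq_lintegral_ofReal hint2 (Eventually.of_forall fun z => sq_nonneg _)]
    refine lintegral_congr fun z => ?_
    rw [← ENNReal.ofReal_pow (abs_nonneg _), sq_abs]
  rw [h6] at h4
  have h7 : ENNReal.ofReal A + ENNReal.ofReal A ≤ ENNReal.ofReal A + M := by
    rw [← two_mul]
    exact le_trans (by gcongr) h4
  have h8 := (ENNReal.add_le_add_iff_left ENNReal.ofReal_ne_top).1 h7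
  exact (ENNReal.ofReal_le_iff_le_toReal hM).1 h8

end CondExp

/-! ### Uniqueness of the two-sided Laplace transform -/

/-- An `L¹` density all of whose exponential moments vanish is zero: its positive and negative
parts define finite measures with the same moment generating function. -/
theorem ae_eq_zero_of_forall_integral_mul_exp_eq_zero {μ : Measure ℝ} [SigmaFinite μ] {f : ℝ → ℝ}
    (hf : Measurable f) (hint : ∀ t : ℝ, Integrable (fun x => f x * Real.exp (t * x)) μ)
    (h0 : ∀ t : ℝ, ∫ x, f x * Real.exp (t * x) ∂μ = 0) : f =ᵐ[μ] 0 := by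
  have hfi : Integrable f μ := by simpa using hint 0
  -- integrability of the positive part of the density against the exponentials
  have hI : ∀ g : ℝ → ℝ, Measurable g → (∀ t : ℝ, Integrable (fun x => g x * Real.exp (t * x)) μ) →
      ∀ t : ℝ, Integrable (fun x => max (g x) 0 * Real.exp (t * x)) μ := by
    intro g hg hgi t
    refine ((hgi t).mono (by fun_prop) (Eventually.of_forall fun x => ?_))
    rw [norm_mul, norm_mul]
    refine mul_le_mul_of_nonneg_right ?_ (norm_nonneg _)
    rw [Real.norm_eq_abs, Real.norm_eq_abs, abs_of_nonneg (a := max (g x) 0) (le_max_right _ _)]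
    exact max_le (le_abs_self _) (abs_nonneg _)
  have aux : ∀ g : ℝ → ℝ, Measurable g → (∀ t : ℝ, Integrable (fun x => g x * Real.exp (t * x)) μ) →
      ∀ t : ℝ, Integrable (fun x => Real.exp (t * x))
        (μ.withDensity fun x => ENNReal.ofReal (g x)) ∧
      mgf id (μ.withDensity fun x => ENNReal.ofReal (g x)) t =
        ∫ x, max (g x) 0 * Real.exp (t * x) ∂μ := fun g hg hgi t =>
    ⟨(integrable_withDensity_iff_integrable_smul hg.real_toNNReal).2 (hI g hg hgi t),
      integral_withDensity_eq_integral_smul hg.real_toNNReal _⟩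
  have hneg : ∀ t : ℝ, Integrable (fun x => (-f) x * Real.exp (t * x)) μ := fun t => by
    simpa using (hint t).neg
  have hp := aux f hf hint
  have hn := aux (-f) hf.neg hneg
  set p := μ.withDensity fun x => ENNReal.ofReal (f x)
  set n := μ.withDensity fun x => ENNReal.ofReal ((-f) x)
  have hfinp : IsFiniteMeasure p := isFiniteMeasure_withDensity_ofReal hfi.2
  have hfinn : IsFiniteMeasure n := isFiniteMeasure_withDensity_ofReal hfi.neg.2
  have hmgf : mgf id p = mgf id n := by
    funext t
    rw [(hp t).2, (hn t).2, ← sub_eq_zero, ← integral_sub (hI f hf hint t) (hI (-f) hf.neg hneg t)]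
    refine Eq.trans ?_ (h0 t)
    refine integral_congr_ae (Eventually.of_forall fun x => ?_)
    simp only [← sub_mul, Pi.neg_apply]
    congr 1
    exact max_zero_sub_max_neg_zero_eq_self (f x)
  have hzero : p = 0 ↔ n = 0 := by
    have e1 : mgf id p 0 = p.real Set.univ := by simp [mgf]
    have e2 : mgf id n 0 = n.real Set.univ := by simp [mgf]
    rw [← Measure.measure_univ_eq_zero, ← Measure.measure_univ_eq_zero (μ := n),
      ← measureReal_eq_zero_iff, ← measureReal_eq_zero_iff, ← e1, ← e2, hmgf]
  have huniv : integrableExpSet id p = Set.univ := Set.eq_univ_of_forall fun t => (hp t).1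
  have hcm := eqOn_complexMGF_of_mgf' hmgf hzero
  have hpn : p = n := Measure.ext_of_complexMGF_id_eq (funext fun z => hcm (by simp [huniv]))
  have hae := (withDensity_eq_iff_of_sigmaFinite (by fun_prop) (by fun_prop)).1 hpn
  filter_upwards [hae] with x hx
  simp only [Pi.neg_apply] at hx
  rcases le_total (f x) 0 with h | h
  · rw [ENNReal.ofReal_of_nonpos h] at hx
    have := ENNReal.ofReal_eq_zero.1 hx.symm
    exact le_antisymm h (neg_nonpos.1 this)
  · rw [ENNReal.ofReal_of_nonpos (p := -f x) (by linarith)] at hx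
    exact le_antisymm (ENNReal.ofReal_eq_zero.1 hx) h

/-! ### Infinite-dimensionality of `L²` -/

/-- `L²(μ)` is infinite-dimensional as soon as `μ` charges infinitely many disjoint sets. -/
theorem not_finiteDimensional_Lp_two {μ : Measure ℝ} [IsFiniteMeasure μ]
    (h : ∀ k : ℕ, 0 < μ (Set.Ico (k : ℝ) (k + 1))) : ¬ FiniteDimensional ℝ (Lp ℝ 2 μ) := by
  intro hfd
  let b : ℕ → Lp ℝ 2 μ := fun k =>
    indicatorConstLp 2 (measurableSet_Ico (a := (k : ℝ)) (b := k + 1)) (measure_ne_top μ _) (1 : ℝ)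
  have hli : LinearIndependent ℝ b := by
    refine linearIndependent_of_ne_zero_of_inner_eq_zero (𝕜 := ℝ) (fun k => ?_) fun i j hij => ?_
    · rw [← norm_pos_iff]
      change 0 < ‖indicatorConstLp _ _ _ _‖
      rw [norm_indicatorConstLp (by norm_num) (by norm_num)]
      have : 0 < μ.real (Set.Ico (k : ℝ) (k + 1)) :=
        ENNReal.toReal_pos (h k).ne' (measure_ne_top μ _)
      simp only [norm_one, one_mul]
      positivity
    · change inner ℝ (indicatorConstLp _ _ _ _) (b j) = 0
      rw [L2.inner_indicatorConstLp_one]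
      have hdisj : Disjoint (Set.Ico (i : ℝ) (i + 1)) (Set.Ico (j : ℝ) (j + 1)) := by
        refine Set.disjoint_left.2 fun x hi hj => hij ?_
        have h1 : i < j + 1 := by exact_mod_cast hi.1.trans_lt hj.2
        have h2 : j < i + 1 := by exact_mod_cast hj.1.trans_lt hi.2
        omega
      rw [setIntegral_congr_ae (g := fun _ => (0 : ℝ)) measurableSet_Ico, integral_zero]
      filter_upwards [indicatorConstLp_coeFn (p := 2)
        (hs := measurableSet_Ico (a := (j : ℝ)) (b := j + 1)) (hμs := measure_ne_top μ _)
        (c := (1 : ℝ))] with x hx hxi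
      rw [hx, Set.indicator_of_notMem (Set.disjoint_left.1 hdisj hxi)]
  exact Module.Finite.not_linearIndependent_of_infinite b hli

/-! ### Comparison of two Gaussian densities -/

/-- The quotient `φ_{p,v₁}² / φ_{r,v}` of Gaussian densities is, up to an explicit constant, again a
Gaussian density; here `w = 2 v - v₁ > 0`. -/
theorem gaussianPDFReal_sq_eq {v₁ v w : ℝ≥0} (hv₁ : 0 < v₁) (hv : 0 < v) (hw : 0 < w)
    (h : (v₁ : ℝ) + w = 2 * v) (p r s : ℝ) :
    gaussianPDFReal p v₁ s ^ 2 =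
      (v / √(v₁ * w) * Real.exp ((p - r) ^ 2 / w) *
        gaussianPDFReal ((2 * v * p - v₁ * r) / w) (v₁ * v / w) s) * gaussianPDFReal r v s := by
  have hv₁' : (0 : ℝ) < v₁ := hv₁
  have hv' : (0 : ℝ) < v := hv
  have hw' : (0 : ℝ) < w := hw
  have hpi := Real.pi_pos
  have hexp : Real.exp (-(s - p) ^ 2 / (2 * v₁)) ^ 2 =
      Real.exp ((p - r) ^ 2 / w) *
        Real.exp (-(s - (2 * v * p - v₁ * r) / w) ^ 2 / (2 * (v₁ * v / w))) *
        Real.exp (-(s - r) ^ 2 / (2 * v)) := by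
    rw [← Real.exp_nat_mul, ← Real.exp_add, ← Real.exp_add]
    congr 1
    have hw2 : (v₁ : ℝ) = 2 * v - w := by linarith
    have hne : (2 * v - w : ℝ) ≠ 0 := by rw [← hw2]; exact hv₁'.ne'
    rw [hw2]
    push_cast
    field_simp
    ring
  have hconst : (√(2 * Real.pi * v₁))⁻¹ ^ 2 =
      v / √(v₁ * w) * (√(2 * Real.pi * (v₁ * v / w)))⁻¹ * (√(2 * Real.pi * v))⁻¹ := by
    have e1 : √(2 * Real.pi * (v₁ * v / w)) * √(2 * Real.pi * v) * √(v₁ * w) =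
        2 * Real.pi * v₁ * v := by
      rw [← Real.sqrt_mul (by positivity), ← Real.sqrt_mul (by positivity),
        Real.sqrt_eq_iff_mul_self_eq (by positivity) (by positivity)]
      field_simp
    rw [inv_pow, Real.sq_sqrt (by positivity)]
    have e2 : v / √(v₁ * w) * (√(2 * Real.pi * (v₁ * v / w)))⁻¹ * (√(2 * Real.pi * v))⁻¹ =
        v / (√(2 * Real.pi * (v₁ * v / w)) * √(2 * Real.pi * v) * √(v₁ * w)) := by
      field_simp
    rw [e2, e1]
    field_simp
  simp only [gaussianPDFReal, NNReal.coe_div, NNReal.coe_mul]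
  rw [mul_pow, hexp, hconst]
  ring

/-- The weighted inequality `2 g a ≤ g² b + a² / b`, with `d = a² / b`. -/
theorem two_mul_mul_ofReal_le {a b d : ℝ} (hb : 0 < b) (hd : 0 ≤ d)
    (h : a ^ 2 = d * b) (g : ℝ≥0∞) :
    2 * (g * ENNReal.ofReal a) ≤ g ^ 2 * ENNReal.ofReal b + ENNReal.ofReal d := by
  rcases eq_or_ne g ∞ with rfl | hg
  · simp [ENNReal.top_mul (ENNReal.ofReal_pos.2 hb).ne']
  · lift g to ℝ≥0 using hg
    have h1 : 2 * ((g : ℝ) * a) ≤ (g : ℝ) ^ 2 * b + d := by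
      refine le_of_mul_le_mul_right ?_ hb
      nlinarith [sq_nonneg ((g : ℝ) * b - a)]
    have h2 := ENNReal.ofReal_le_ofReal h1
    rwa [ENNReal.ofReal_add (by positivity) hd, ENNReal.ofReal_mul (by positivity),
      ENNReal.ofReal_mul (by positivity), ENNReal.ofReal_mul (by positivity),
      ENNReal.ofReal_pow (by positivity), ENNReal.ofReal_coe_nnreal,
      show ENNReal.ofReal 2 = 2 by norm_num] at h2

theorem two_mul_lintegral_gaussianPDF_le {v₁ v w : ℝ≥0} (hv₁ : 0 < v₁) (hv : 0 < v) (hw : 0 < w)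
    (h : (v₁ : ℝ) + w = 2 * v) (p r : ℝ) {g : ℝ → ℝ≥0∞} :
    2 * ∫⁻ s, g s * gaussianPDF p v₁ s ≤ (∫⁻ s, g s ^ 2 * gaussianPDF r v s) +
      ENNReal.ofReal (v / √(v₁ * w)) * ENNReal.ofReal (Real.exp ((p - r) ^ 2 / w)) := by
  have hv' : v₁ * v / w ≠ 0 := (by positivity : 0 < v₁ * v / w).ne'
  set c : ℝ := v / √(v₁ * w) * Real.exp ((p - r) ^ 2 / w) with hc
  have hc0 : 0 ≤ c := by positivity
  set m : ℝ := (2 * v * p - v₁ * r) / w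
  calc 2 * ∫⁻ s, g s * gaussianPDF p v₁ s
      ≤ ∫⁻ s, 2 * (g s * gaussianPDF p v₁ s) := lintegral_const_mul_le _ _
    _ ≤ ∫⁻ s, (g s ^ 2 * gaussianPDF r v s +
          ENNReal.ofReal c * gaussianPDF m (v₁ * v / w) s) := by
        refine lintegral_mono fun s => ?_
        have := two_mul_mul_ofReal_le
          (gaussianPDFReal_pos r v s hv.ne')
          (mul_nonneg hc0 (gaussianPDFReal_nonneg m (v₁ * v / w) s))
          (gaussianPDFReal_sq_eq hv₁ hv hw h p r s) (g s)
        rwa [ENNReal.ofReal_mul hc0] at this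
    _ = _ := by
        rw [lintegral_add_right _ ((measurable_gaussianPDF _ _).const_mul _),
          lintegral_const_mul _ (measurable_gaussianPDF _ _), lintegral_gaussianPDF_eq_one _ hv',
          mul_one, hc, ENNReal.ofReal_mul (by positivity)]

/-- Adding an independent Gaussian variable `W` to a function `h` of `A` gives the mixture of the
Gaussian laws centred at `h`. -/
theorem lintegral_add_gaussian {Ω α : Type*} [MeasurableSpace Ω] [MeasurableSpace α]
    {P : Measure Ω} [IsProbabilityMeasure P] {A : Ω → α} {W : Ω → ℝ} (hA : Measurable A)
    (hW : Measurable W) (hAW : IndepFun A W P) {v : ℝ≥0} (hv : v ≠ 0)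
    (hWlaw : P.map W = gaussianReal 0 v) {h : α → ℝ} (hh : Measurable h)
    {F : α × ℝ → ℝ≥0∞} (hF : Measurable F) :
    ∫⁻ ω, F (A ω, h (A ω) + W ω) ∂P =
      ∫⁻ a, (∫⁻ s, F (a, s) * gaussianPDF (h a) v s) ∂(P.map A) := by
  have hF' : Measurable fun z : α × ℝ => F (z.1, h z.1 + z.2) := by fun_prop
  have hprod := (indepFun_iff_map_prod_eq_prod_map_map hA.aemeasurable hW.aemeasurable).1 hAW
  have : IsProbabilityMeasure (P.map A) := Measure.isProbabilityMeasure_map hA.aemeasurable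
  have e1 := lintegral_map (μ := P) hF' (hA.prodMk hW)
  rw [hprod, hWlaw, lintegral_prod _ hF'.aemeasurable] at e1
  rw [← e1]
  refine lintegral_congr fun a => ?_
  have hg : Measurable fun s => F (a, s) := by fun_prop
  have e2 := lintegral_map (μ := gaussianReal 0 v) hg (measurable_const_add (h a))
  rw [gaussianReal_map_const_add, zero_add, gaussianReal_of_var_ne_zero _ hv,
    lintegral_withDensity_eq_lintegral_mul _ (measurable_gaussianPDF _ _) hg] at e2
  rw [← e2]
  exact lintegral_congr fun s => mul_comm _ _

theorem measurable_lintegral_mul_gaussianPDF {α : Type*} [MeasurableSpace α] {v : ℝ≥0}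
    {h : α → ℝ} (hh : Measurable h) {F : α × ℝ → ℝ≥0∞} (hF : Measurable F) :
    Measurable fun a => ∫⁻ s, F (a, s) * gaussianPDF (h a) v s := by
  have h1 : Measurable fun z : α × ℝ => gaussianPDF (h z.1) v z.2 :=
    measurable_uncurry_gaussianPDF.comp
      ((hh.comp measurable_fst).prodMk (measurable_const.prodMk measurable_snd))
  exact (hF.mul h1).lintegral_prod_right'

/-! ### The noisy random walk -/

/-- The standing assumptions: `X i` i.i.d. and sub-Gaussian, `Z i` i.i.d. `N(0, δ²)`, all
independent. -/
structure NoisyWalk {Ω : Type*} [MeasurableSpace Ω] (P : Measure Ω) (X Z : ℕ → Ω → ℝ) (δ : ℝ) :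
    Prop where
  measurable_X : ∀ i, Measurable (X i)
  measurable_Z : ∀ i, Measurable (Z i)
  pos : 0 < δ
  indep : iIndepFun (fun j : ℕ ⊕ ℕ => Sum.elim X Z j) P
  ident : ∀ i, IdentDistrib (X i) (X 0) P P
  sub : IsSubGaussian (X 0) P
  gauss : ∀ i, P.map (Z i) = gaussianReal 0 (Real.toNNReal (δ ^ 2))

/-- The `σ`-algebra generated by the variables of `X` and `Z` with index in `s`; an index is
`Sum.inl i` for `X i` and `Sum.inr i` for `Z i`. -/
abbrev generatedBy {Ω : Type*} (X Z : ℕ → Ω → ℝ) (s : Set (ℕ ⊕ ℕ)) : MeasurableSpace Ω :=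
  ⨆ j ∈ s, MeasurableSpace.comap (Sum.elim X Z j) inferInstance

theorem measurable_generatedBy_inl {Ω : Type*} (X Z : ℕ → Ω → ℝ) {s : Set (ℕ ⊕ ℕ)} {i : ℕ}
    (hi : Sum.inl i ∈ s) : Measurable[generatedBy X Z s] (X i) := by
  have h : MeasurableSpace.comap (Sum.elim X Z (Sum.inl i)) inferInstance ≤ generatedBy X Z s :=
    le_iSup₂_of_le _ hi le_rfl
  exact Measurable.mono (comap_measurable (X i)) h le_rfl

theorem measurable_generatedBy_inr {Ω : Type*} (X Z : ℕ → Ω → ℝ) {s : Set (ℕ ⊕ ℕ)} {i : ℕ}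
    (hi : Sum.inr i ∈ s) : Measurable[generatedBy X Z s] (Z i) := by
  have h : MeasurableSpace.comap (Sum.elim X Z (Sum.inr i)) inferInstance ≤ generatedBy X Z s :=
    le_iSup₂_of_le _ hi le_rfl
  exact Measurable.mono (comap_measurable (Z i)) h le_rfl

namespace NoisyWalk

variable {Ω : Type*} [MeasurableSpace Ω] {P : Measure Ω} {X Z : ℕ → Ω → ℝ} {δ : ℝ}

theorem measurable_Y (hw : NoisyWalk P X Z δ) (i : ℕ) : Measurable (regularized X Z i) :=
  measurable_regularized hw.measurable_X hw.measurable_Z i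

theorem measurable_S (hw : NoisyWalk P X Z δ) (n : ℕ) :
    Measurable (partialSum (regularized X Z) n) :=
  measurable_partialSum hw.measurable_Y n

theorem toNNReal_pos (hw : NoisyWalk P X Z δ) : 0 < Real.toNNReal (δ ^ 2) :=
  Real.toNNReal_pos.2 (sq_pos_of_pos hw.pos)

theorem indepFun_of_disjoint (hw : NoisyWalk P X Z δ) {α β : Type*} [MeasurableSpace α]
    [MeasurableSpace β] {s t : Set (ℕ ⊕ ℕ)} (hst : Disjoint s t) {A : Ω → α} {B : Ω → β}
    (hA : Measurable[generatedBy X Z s] A) (hB : Measurable[generatedBy X Z t] B) :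
    IndepFun A B P := by
  rw [IndepFun_iff_Indep]
  have hm : ∀ j : ℕ ⊕ ℕ, Measurable (Sum.elim X Z j) := by
    rintro (i | i)
    · exact hw.measurable_X i
    · exact hw.measurable_Z i
  exact indep_of_indep_of_le_left (indep_of_indep_of_le_right
    (indep_iSup_of_disjoint (fun j => (hm j).comap_le) hw.indep.iIndep hst) hB.comap_le) hA.comap_le

variable [IsProbabilityMeasure P]

theorem map_sum_Z (hw : NoisyWalk P X Z δ) (s : Finset ℕ) :
    P.map (fun ω => ∑ i ∈ s, Z i ω) = gaussianReal 0 (s.card * Real.toNNReal (δ ^ 2)) := by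
  induction s using Finset.induction_on with
  | empty => simp [gaussianReal_zero_var, Measure.map_const]
  | insert i s hi ih =>
    have hind : IndepFun (Z i) (fun ω => ∑ i ∈ s, Z i ω) P := by
      refine hw.indepFun_of_disjoint (s := {Sum.inr i}) (t := Sum.inr '' (s : Set ℕ)) ?_
        (measurable_generatedBy_inr X Z rfl)
        (Finset.measurable_sum _ fun j hj => measurable_generatedBy_inr X Z ⟨j, hj, rfl⟩)
      rw [Set.disjoint_singleton_left]
      rintro ⟨j, hj, hji⟩
      exact hi (Sum.inr.inj hji ▸ hj)
    have h := gaussianReal_add_gaussianReal_of_indepFun hind (hw.gauss i) ih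
    rw [Finset.card_insert_of_notMem hi, add_comm (s.card), Nat.cast_add, Nat.cast_one, add_mul,
      one_mul]
    rw [zero_add] at h
    rw [← h]
    congr 1
    funext ω
    rw [Finset.sum_insert hi]
    rfl

/-- The law of `(Y 0, S (m + 1))`: given `Y 0 = y` and `X 1 + ⋯ + X m = t`, the sum is
`N(y + t, m δ²)`. -/
theorem lintegral_joint (hw : NoisyWalk P X Z δ) {m : ℕ} (hm : 0 < m) {G : ℝ × ℝ → ℝ≥0∞}
    (hG : Measurable G) :
    ∫⁻ ω, G (regularized X Z 0 ω, partialSum (regularized X Z) (m + 1) ω) ∂P =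
      ∫⁻ y, ∫⁻ t, (∫⁻ s, G (y, s) * gaussianPDF (y + t) (m * Real.toNNReal (δ ^ 2)) s)
        ∂(P.map fun ω => ∑ i ∈ Finset.Ico 1 (m + 1), X i ω) ∂(P.map (regularized X Z 0)) := by
  set T : Ω → ℝ := fun ω => ∑ i ∈ Finset.Ico 1 (m + 1), X i ω with hT
  set W : Ω → ℝ := fun ω => ∑ i ∈ Finset.Ico 1 (m + 1), Z i ω with hW
  have hTm : Measurable T := Finset.measurable_sum _ fun i _ => hw.measurable_X i
  have hWm : Measurable W := Finset.measurable_sum _ fun i _ => hw.measurable_Z i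
  have hYm := hw.measurable_Y 0
  have hYT : IndepFun (regularized X Z 0) T P := by
    refine hw.indepFun_of_disjoint (s := {Sum.inl 0, Sum.inr 0}) (t := Sum.inl '' Set.Ici 1) ?_
      ((measurable_generatedBy_inl X Z (by simp)).add (measurable_generatedBy_inr X Z (by simp)))
      (Finset.measurable_sum _ fun j hj =>
        measurable_generatedBy_inl X Z ⟨j, (Finset.mem_Ico.1 hj).1, rfl⟩)
    rw [Set.disjoint_left]
    rintro _ (rfl | rfl) <;> simp
  have hYTW : IndepFun (fun ω => (regularized X Z 0 ω, T ω)) W P := by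
    refine hw.indepFun_of_disjoint (s := {Sum.inr 0} ∪ Set.range Sum.inl)
      (t := Sum.inr '' Set.Ici 1) ?_
      (((measurable_generatedBy_inl X Z (by simp)).add
        (measurable_generatedBy_inr X Z (by simp))).prodMk
        (Finset.measurable_sum _ fun j hj => measurable_generatedBy_inl X Z (by simp)))
      (Finset.measurable_sum _ fun j hj =>
        measurable_generatedBy_inr X Z ⟨j, (Finset.mem_Ico.1 hj).1, rfl⟩)
    rw [Set.disjoint_left]
    rintro _ (rfl | ⟨i, rfl⟩) <;> simp
  have hWlaw : P.map W = gaussianReal 0 (m * Real.toNNReal (δ ^ 2)) := by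
    rw [hw.map_sum_Z]; simp
  have hv : (m * Real.toNNReal (δ ^ 2) : ℝ≥0) ≠ 0 :=
    (mul_pos (by exact_mod_cast hm) hw.toNNReal_pos).ne'
  have hF : Measurable fun z : (ℝ × ℝ) × ℝ => G (z.1.1, z.2) := by fun_prop
  have h1 := lintegral_add_gaussian (hYm.prodMk hTm) hWm hYTW hv hWlaw
    (measurable_fst.add measurable_snd) hF
  rw [(indepFun_iff_map_prod_eq_prod_map_map hYm.aemeasurable hTm.aemeasurable).1 hYT,
    lintegral_prod _ (measurable_lintegral_mul_gaussianPDF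
      (measurable_fst.add measurable_snd) hF).aemeasurable] at h1
  refine Eq.trans (lintegral_congr fun ω => ?_) h1
  have hS : partialSum (regularized X Z) (m + 1) ω = regularized X Z 0 ω + T ω + W ω := by
    rw [partialSum, Finset.range_eq_Ico, Finset.sum_eq_sum_Ico_succ_bot (Nat.succ_pos m), add_assoc,
      hT, hW, ← Finset.sum_add_distrib]
    rfl
  rw [hS]
  rfl

/-- The law of `S (m + 1)`: given `X 0 = x` and `X 1 + ⋯ + X m = t`, the sum is
`N(x + t, (m + 1) δ²)`. -/
theorem lintegral_partialSum (hw : NoisyWalk P X Z δ) (m : ℕ) {g : ℝ → ℝ≥0∞}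
    (hg : Measurable g) :
    ∫⁻ s, g s ∂(P.map (partialSum (regularized X Z) (m + 1))) =
      ∫⁻ x, ∫⁻ t, (∫⁻ s, g s * gaussianPDF (x + t) ((m + 1) * Real.toNNReal (δ ^ 2)) s)
        ∂(P.map fun ω => ∑ i ∈ Finset.Ico 1 (m + 1), X i ω) ∂(P.map (X 0)) := by
  set T : Ω → ℝ := fun ω => ∑ i ∈ Finset.Ico 1 (m + 1), X i ω with hT
  set W : Ω → ℝ := fun ω => ∑ i ∈ Finset.range (m + 1), Z i ω with hW
  have hTm : Measurable T := Finset.measurable_sum _ fun i _ => hw.measurable_X i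
  have hWm : Measurable W := Finset.measurable_sum _ fun i _ => hw.measurable_Z i
  have hXm := hw.measurable_X 0
  have hXT : IndepFun (X 0) T P := by
    refine hw.indepFun_of_disjoint (s := {Sum.inl 0}) (t := Sum.inl '' Set.Ici 1) ?_
      (measurable_generatedBy_inl X Z (by simp))
      (Finset.measurable_sum _ fun j hj =>
        measurable_generatedBy_inl X Z ⟨j, (Finset.mem_Ico.1 hj).1, rfl⟩)
    simp
  have hXTW : IndepFun (fun ω => (X 0 ω, T ω)) W P := by
    refine hw.indepFun_of_disjoint (s := Set.range Sum.inl) (t := Set.range Sum.inr) ?_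
      ((measurable_generatedBy_inl X Z (by simp)).prodMk
        (Finset.measurable_sum _ fun j hj => measurable_generatedBy_inl X Z (by simp)))
      (Finset.measurable_sum _ fun j hj => measurable_generatedBy_inr X Z (by simp))
    rw [Set.disjoint_left]
    rintro _ ⟨i, rfl⟩
    simp
  have hWlaw : P.map W = gaussianReal 0 ((m + 1) * Real.toNNReal (δ ^ 2)) := by
    rw [hw.map_sum_Z]; simp
  have hv : ((m + 1) * Real.toNNReal (δ ^ 2) : ℝ≥0) ≠ 0 :=
    (mul_pos (by positivity) hw.toNNReal_pos).ne'
  have hF : Measurable fun z : (ℝ × ℝ) × ℝ => g z.2 := by fun_prop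
  have h1 := lintegral_add_gaussian (hXm.prodMk hTm) hWm hXTW hv hWlaw
    (measurable_fst.add measurable_snd) hF
  rw [(indepFun_iff_map_prod_eq_prod_map_map hXm.aemeasurable hTm.aemeasurable).1 hXT,
    lintegral_prod _ (measurable_lintegral_mul_gaussianPDF
      (measurable_fst.add measurable_snd) hF).aemeasurable] at h1
  rw [lintegral_map hg (hw.measurable_S _)]
  refine Eq.trans (lintegral_congr fun ω => ?_) h1
  have hS : partialSum (regularized X Z) (m + 1) ω = X 0 ω + T ω + W ω := by
    rw [hT, hW, ← Finset.sum_eq_sum_Ico_succ_bot (Nat.succ_pos m) (fun i => X i ω),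
      ← Finset.range_eq_Ico, ← Finset.sum_add_distrib]
    rfl
  rw [hS]
  rfl

/-- Comparison of the joint law of `(Y 0, S (m + 1))` with the product of its marginals. Both are
mixtures of Gaussian laws over the same `t = X 1 + ⋯ + X m`, and the weighted inequality
`2 g a ≤ g² b + a² / b` is applied before mixing. -/
theorem two_mul_lintegral_le (hw : NoisyWalk P X Z δ) {m : ℕ} (hm : 0 < m) {G : ℝ × ℝ → ℝ≥0∞}
    (hG : Measurable G) :
    2 * ∫⁻ ω, G (regularized X Z 0 ω, partialSum (regularized X Z) (m + 1) ω) ∂P ≤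
      ∫⁻ z, G z ^ 2 ∂((P.map (regularized X Z 0)).prod
        (P.map (partialSum (regularized X Z) (m + 1)))) +
      ENNReal.ofReal ((m + 1) / √(m * (m + 2))) *
        ∫⁻ ω, ENNReal.ofReal (Real.exp ((regularized X Z 0 ω - X 1 ω) ^ 2 /
          ((m + 2) * δ ^ 2))) ∂P := by
  set d := Real.toNNReal (δ ^ 2)
  have hdpos : 0 < d := hw.toNNReal_pos
  have hd' : (d : ℝ) = δ ^ 2 := Real.coe_toNNReal _ (sq_nonneg δ)
  have hmpos : (0 : ℝ≥0) < m := by exact_mod_cast hm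
  set μ := P.map (regularized X Z 0)
  set ν := P.map (X 0)
  set τ := P.map (fun ω => ∑ i ∈ Finset.Ico 1 (m + 1), X i ω)
  have hTm : Measurable fun ω => ∑ i ∈ Finset.Ico 1 (m + 1), X i ω :=
    Finset.measurable_sum _ fun i _ => hw.measurable_X i
  have iμ : IsProbabilityMeasure μ :=
    Measure.isProbabilityMeasure_map (hw.measurable_Y 0).aemeasurable
  have iν : IsProbabilityMeasure ν :=
    Measure.isProbabilityMeasure_map (hw.measurable_X 0).aemeasurable
  have iτ : IsProbabilityMeasure τ := Measure.isProbabilityMeasure_map hTm.aemeasurable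
  have iS : IsProbabilityMeasure (P.map (partialSum (regularized X Z) (m + 1))) :=
    Measure.isProbabilityMeasure_map (hw.measurable_S _).aemeasurable
  set c := ENNReal.ofReal ((m + 1) / √(m * (m + 2)))
  set E : ℝ → ℝ → ℝ≥0∞ := fun y x =>
    ENNReal.ofReal (Real.exp ((y - x) ^ 2 / ((m + 2) * δ ^ 2)))
  have hEm : Measurable fun z : ℝ × ℝ => E z.1 z.2 := by fun_prop
  -- the inequality for fixed `y`, `x`, `t`
  have key : ∀ y x t : ℝ, 2 * ∫⁻ s, G (y, s) * gaussianPDF (y + t) (m * d) s ≤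
      (∫⁻ s, G (y, s) ^ 2 * gaussianPDF (x + t) ((m + 1) * d) s) + c * E y x := by
    intro y x t
    have h := two_mul_lintegral_gaussianPDF_le (v₁ := m * d) (v := (m + 1) * d) (w := (m + 2) * d)
      (by positivity) (by positivity) (by positivity) (by push_cast; ring) (y + t) (x + t)
      (g := fun s => G (y, s))
    have e1 : (((m + 1) * d : ℝ≥0) : ℝ) / √(((m * d : ℝ≥0) : ℝ) * ((m + 2) * d : ℝ≥0)) =
        (m + 1) / √(m * (m + 2)) := by
      have hdp : (0 : ℝ) < d := hdpos
      have : ((m * d : ℝ≥0) : ℝ) * ((m + 2) * d : ℝ≥0) = (m * (m + 2)) * (d : ℝ) ^ 2 := by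
        push_cast; ring
      rw [this, Real.sqrt_mul (by positivity), Real.sqrt_sq hdp.le]
      push_cast
      field_simp
    have e2 : (y + t - (x + t)) ^ 2 / (((m + 2) * d : ℝ≥0) : ℝ) =
        (y - x) ^ 2 / ((m + 2) * δ ^ 2) := by
      push_cast
      rw [hd']
      ring
    rwa [e1, e2] at h
  have hjoint := hw.lintegral_joint hm hG
  have hprod : ∫⁻ z, G z ^ 2 ∂(μ.prod (P.map (partialSum (regularized X Z) (m + 1)))) =
      ∫⁻ y, ∫⁻ x, ∫⁻ t, (∫⁻ s, G (y, s) ^ 2 * gaussianPDF (x + t) ((m + 1) * d) s) ∂τ ∂ν ∂μ := by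
    rw [lintegral_prod _ (hG.pow_const 2).aemeasurable]
    exact lintegral_congr fun y =>
      hw.lintegral_partialSum m (g := fun s => G (y, s) ^ 2) (by fun_prop)
  have hExp : ∫⁻ ω, ENNReal.ofReal (Real.exp ((regularized X Z 0 ω - X 1 ω) ^ 2 /
      ((m + 2) * δ ^ 2))) ∂P = ∫⁻ y, ∫⁻ x, E y x ∂ν ∂μ := by
    have hind : IndepFun (regularized X Z 0) (X 1) P := by
      refine hw.indepFun_of_disjoint (s := {Sum.inl 0, Sum.inr 0}) (t := {Sum.inl 1}) (by simp)
        ((measurable_generatedBy_inl X Z (by simp)).add (measurable_generatedBy_inr X Z (by simp)))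
        (measurable_generatedBy_inl X Z (by simp))
    have h1 := lintegral_map (μ := P) hEm ((hw.measurable_Y 0).prodMk (hw.measurable_X 1))
    rw [(indepFun_iff_map_prod_eq_prod_map_map (hw.measurable_Y 0).aemeasurable
      (hw.measurable_X 1).aemeasurable).1 hind, (hw.ident 1).map_eq,
      lintegral_prod _ hEm.aemeasurable] at h1
    exact h1.symm
  rw [hjoint, hprod, hExp]
  have m1 : Measurable fun y => ∫⁻ x, E y x ∂ν :=
    Measurable.lintegral_prod_right' (f := fun z : ℝ × ℝ => E z.1 z.2) hEm
  have m2 : ∀ y, Measurable fun x => E y x := fun y => by fun_prop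
  have m3 : ∀ y, ∫⁻ x, c * E y x ∂ν = c * ∫⁻ x, E y x ∂ν := fun y =>
    lintegral_const_mul _ (m2 y)
  calc 2 * ∫⁻ y, ∫⁻ t, (∫⁻ s, G (y, s) * gaussianPDF (y + t) (m * d) s) ∂τ ∂μ
      ≤ ∫⁻ y, 2 * ∫⁻ t, (∫⁻ s, G (y, s) * gaussianPDF (y + t) (m * d) s) ∂τ ∂μ :=
        lintegral_const_mul_le _ _
    _ ≤ ∫⁻ y, (∫⁻ x, ∫⁻ t, (∫⁻ s, G (y, s) ^ 2 * gaussianPDF (x + t) ((m + 1) * d) s) ∂τ ∂ν +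
          ∫⁻ x, c * E y x ∂ν) ∂μ := by
        refine lintegral_mono fun y => ?_
        rw [← lintegral_add_right _ ((m2 y).const_mul c)]
        have h1 : 2 * ∫⁻ t, (∫⁻ s, G (y, s) * gaussianPDF (y + t) (m * d) s) ∂τ =
            ∫⁻ _ : ℝ, 2 * ∫⁻ t, (∫⁻ s, G (y, s) * gaussianPDF (y + t) (m * d) s) ∂τ ∂ν := by
          rw [lintegral_const, measure_univ, mul_one]
        rw [h1]
        refine lintegral_mono fun x => ?_
        have h2 : c * E y x = ∫⁻ _ : ℝ, c * E y x ∂τ := by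
          rw [lintegral_const, measure_univ, mul_one]
        rw [h2, ← lintegral_add_right _ measurable_const]
        exact (lintegral_const_mul_le _ _).trans (lintegral_mono fun t => key y x t)
    _ = _ := by
        simp only [m3]
        rw [lintegral_add_right _ (m1.const_mul c), lintegral_const_mul _ m1]

end NoisyWalk

namespace NoisyWalk

variable {Ω : Type*} [MeasurableSpace Ω] {P : Measure Ω} {X Z : ℕ → Ω → ℝ} {δ : ℝ}

/-! ### Exponential moments, marginals and independence -/

theorem exists_integrable_exp_sq_X (hw : NoisyWalk P X Z δ) :
    ∃ c, 0 < c ∧ ∀ i, Integrable (fun ω => Real.exp (c * X i ω ^ 2)) P := by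
  obtain ⟨K, hK, hle⟩ := hw.sub
  refine ⟨1 / K ^ 2, by positivity, fun i => ?_⟩
  have h0 : Integrable (fun ω => Real.exp (1 / K ^ 2 * X 0 ω ^ 2)) P := by
    have hm := hw.measurable_X 0
    refine ⟨by fun_prop, ?_⟩
    rw [hasFiniteIntegral_iff_ofReal (Eventually.of_forall fun ω => (Real.exp_pos _).le)]
    refine lt_of_le_of_lt (le_of_eq ?_) (hle.trans_lt ENNReal.ofNat_lt_top)
    refine lintegral_congr fun ω => ?_
    congr 2
    ring
  have h1 := (hw.ident i).comp (u := fun x => Real.exp (1 / K ^ 2 * x ^ 2)) (by fun_prop)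
  exact h1.integrable_iff.2 h0

theorem exists_integrable_exp_sq_Z (hw : NoisyWalk P X Z δ) :
    ∃ c, 0 < c ∧ ∀ i, Integrable (fun ω => Real.exp (c * Z i ω ^ 2)) P := by
  obtain ⟨c, hc, hint⟩ :=
    IsGaussian.exists_integrable_exp_sq (gaussianReal 0 (Real.toNNReal (δ ^ 2)))
  refine ⟨c, hc, fun i => ?_⟩
  rw [← hw.gauss i] at hint
  have h := hint.comp_measurable (hw.measurable_Z i)
  simpa [Function.comp_def] using h

theorem integrable_exp_mul_X [IsProbabilityMeasure P] (hw : NoisyWalk P X Z δ) (i : ℕ) (t : ℝ) :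
    Integrable (fun ω => Real.exp (t * X i ω)) P := by
  obtain ⟨c, hc, hint⟩ := hw.exists_integrable_exp_sq_X
  have hm := hw.measurable_X i
  refine ((hint i).const_mul (Real.exp (t ^ 2 / (4 * c)))).mono (by fun_prop)
    (Eventually.of_forall fun ω => ?_)
  rw [Real.norm_of_nonneg (Real.exp_pos _).le, Real.norm_of_nonneg (by positivity), ← Real.exp_add]
  refine Real.exp_le_exp.2 ?_
  have h : t ^ 2 / (4 * c) + c * X i ω ^ 2 - t * X i ω = c * (X i ω - t / (2 * c)) ^ 2 := by
    field_simp
    ring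
  have : 0 ≤ c * (X i ω - t / (2 * c)) ^ 2 := by positivity
  linarith

theorem integrable_exp_mul_Z (hw : NoisyWalk P X Z δ) (i : ℕ) (t : ℝ) :
    Integrable (fun ω => Real.exp (t * Z i ω)) P := by
  have h := integrable_exp_mul_gaussianReal (μ := 0) (v := Real.toNNReal (δ ^ 2)) t
  rw [← hw.gauss i] at h
  exact h.comp_measurable (hw.measurable_Z i)

theorem zero_mem_interior_integrableExpSet (hw : NoisyWalk P X Z δ) :
    0 ∈ interior (integrableExpSet (fun ω => (regularized X Z 0 ω - X 1 ω) ^ 2) P) := by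
  obtain ⟨a, ha, hX⟩ := hw.exists_integrable_exp_sq_X
  obtain ⟨b, hb, hZ⟩ := hw.exists_integrable_exp_sq_Z
  have mX0 := hw.measurable_X 0
  have mX1 := hw.measurable_X 1
  have mZ0 := hw.measurable_Z 0
  have mY := hw.measurable_Y 0
  set c := min a b / 9 with hc
  have hcpos : 0 < c := by positivity
  rw [mem_interior_iff_mem_nhds]
  refine mem_of_superset (Iio_mem_nhds hcpos) fun t ht => ?_
  refine (((hX 0).add (hZ 0)).add (hX 1)).mono (by fun_prop) (Eventually.of_forall fun ω => ?_)
  simp only [Pi.add_apply]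
  rw [Real.norm_of_nonneg (Real.exp_pos _).le, Real.norm_of_nonneg (by positivity)]
  set x := X 0 ω
  set z := Z 0 ω
  set y := X 1 ω
  have hD : regularized X Z 0 ω - X 1 ω = x + z - y := rfl
  rw [hD]
  have hca : 9 * c ≤ a := by rw [hc]; linarith [min_le_left a b]
  have hcb : 9 * c ≤ b := by rw [hc]; linarith [min_le_right a b]
  have h1 : t * (x + z - y) ^ 2 ≤ c * (3 * (x ^ 2 + z ^ 2 + y ^ 2)) :=
    mul_le_mul (le_of_lt ht) (by nlinarith [sq_nonneg (x - z), sq_nonneg (x + y), sq_nonneg (z + y)])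
      (sq_nonneg _) hcpos.le
  have hx2 := sq_nonneg x
  have hz2 := sq_nonneg z
  have hy2 := sq_nonneg y
  -- the largest of the three squares dominates their mean
  rcases le_total (x ^ 2) (z ^ 2) with h | h <;> rcases le_total (z ^ 2) (y ^ 2) with h' | h' <;>
    rcases le_total (x ^ 2) (y ^ 2) with h'' | h''
  all_goals
    first
    | exact le_trans (Real.exp_le_exp.2 (show _ ≤ a * x ^ 2 by nlinarith)) (by
        have := Real.exp_pos (b * z ^ 2); have := Real.exp_pos (a * y ^ 2); linarith)
    | exact le_trans (Real.exp_le_exp.2 (show _ ≤ b * z ^ 2 by nlinarith)) (by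
        have := Real.exp_pos (a * x ^ 2); have := Real.exp_pos (a * y ^ 2); linarith)
    | exact le_trans (Real.exp_le_exp.2 (show _ ≤ a * y ^ 2 by nlinarith)) (by
        have := Real.exp_pos (b * z ^ 2); have := Real.exp_pos (a * x ^ 2); linarith)

theorem memLp_Z (hw : NoisyWalk P X Z δ) (i : ℕ) : MemLp (Z i) 2 P := by
  refine memLp_of_mem_interior_integrableExpSet ?_ 2
  have : integrableExpSet (Z i) P = Set.univ := Set.eq_univ_of_forall (hw.integrable_exp_mul_Z i)
  simp [this]

theorem variance_Z (hw : NoisyWalk P X Z δ) (i : ℕ) : variance (Z i) P = δ ^ 2 := by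
  have h := variance_map (μ := P) (X := id) (Y := Z i) aemeasurable_id
    (hw.measurable_Z i).aemeasurable
  rw [hw.gauss i, variance_id_gaussianReal, Real.coe_toNNReal _ (sq_nonneg δ)] at h
  exact h.symm

theorem integral_Z (hw : NoisyWalk P X Z δ) (i : ℕ) : ∫ ω, Z i ω ∂P = 0 := by
  have h := integral_map (μ := P) (hw.measurable_Z i).aemeasurable
    (f := fun x : ℝ => x) (by fun_prop)
  rw [hw.gauss i, integral_id_gaussianReal] at h
  exact h.symm

theorem indepFun_X_Z (hw : NoisyWalk P X Z δ) (i j : ℕ) : IndepFun (X i) (Z j) P :=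
  hw.indep.indepFun (i := Sum.inl i) (j := Sum.inr j) (by simp)

theorem indepFun_Y (hw : NoisyWalk P X Z δ) {i j : ℕ} (hij : i ≠ j) :
    IndepFun (regularized X Z i) (regularized X Z j) P := by
  refine hw.indepFun_of_disjoint (s := {Sum.inl i, Sum.inr i}) (t := {Sum.inl j, Sum.inr j}) ?_
    ((measurable_generatedBy_inl X Z (by simp)).add (measurable_generatedBy_inr X Z (by simp)))
    ((measurable_generatedBy_inl X Z (by simp)).add (measurable_generatedBy_inr X Z (by simp)))
  rw [Set.disjoint_left]
  rintro _ (rfl | rfl) <;> simp [hij]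

theorem indepFun_Y_X (hw : NoisyWalk P X Z δ) : IndepFun (regularized X Z 0) (X 1) P :=
  hw.indepFun_of_disjoint (s := {Sum.inl 0, Sum.inr 0}) (t := {Sum.inl 1}) (by simp)
    ((measurable_generatedBy_inl X Z (by simp)).add (measurable_generatedBy_inr X Z (by simp)))
    (measurable_generatedBy_inl X Z (by simp))

variable [IsProbabilityMeasure P]

theorem memLp_X (hw : NoisyWalk P X Z δ) (i : ℕ) : MemLp (X i) 2 P := by
  refine memLp_of_mem_interior_integrableExpSet ?_ 2
  have : integrableExpSet (X i) P = Set.univ := Set.eq_univ_of_forall (hw.integrable_exp_mul_X i)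
  simp [this]

theorem memLp_Y (hw : NoisyWalk P X Z δ) (i : ℕ) : MemLp (regularized X Z i) 2 P :=
  (hw.memLp_X i).add (hw.memLp_Z i)

theorem memLp_S (hw : NoisyWalk P X Z δ) (n : ℕ) :
    MemLp (partialSum (regularized X Z) n) 2 P :=
  memLp_finsetSum _ fun i _ => hw.memLp_Y i

theorem integrable_exp_mul_S (hw : NoisyWalk P X Z δ) (n : ℕ) (t : ℝ) :
    Integrable (fun ω => Real.exp (t * partialSum (regularized X Z) n ω)) P := by
  have h := hw.indep.integrable_exp_mul_sum (t := t)
    (s := (Finset.range n).disjSum (Finset.range n))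
    (by rintro (i | i); exacts [hw.measurable_X i, hw.measurable_Z i])
    (by rintro (i | i) -; exacts [hw.integrable_exp_mul_X i t, hw.integrable_exp_mul_Z i t])
  refine h.congr (Eventually.of_forall fun ω => ?_)
  simp only [Finset.sum_apply, Finset.sum_disjSum, Sum.elim_inl, Sum.elim_inr, partialSum,
    regularized, Finset.sum_add_distrib]

/-! ### Second moments of the sums -/

theorem variance_Y (hw : NoisyWalk P X Z δ) (i : ℕ) :
    variance (regularized X Z i) P = variance (X 0) P + δ ^ 2 := by
  have h := (hw.indepFun_X_Z i i).variance_fun_add (hw.memLp_X i) (hw.memLp_Z i)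
  rw [(hw.ident i).variance_eq, hw.variance_Z] at h
  exact h

theorem variance_Y_pos (hw : NoisyWalk P X Z δ) (i : ℕ) :
    0 < variance (regularized X Z i) P := by
  rw [hw.variance_Y]
  have := variance_nonneg (X 0) P
  have := sq_pos_of_pos hw.pos
  linarith

theorem variance_S (hw : NoisyWalk P X Z δ) (n : ℕ) :
    variance (partialSum (regularized X Z) n) P = n * variance (regularized X Z 0) P := by
  have h := IndepFun.variance_sum (s := Finset.range n) (fun i _ => hw.memLp_Y i)
    (fun i _ j _ hij => hw.indepFun_Y hij)
  have e : partialSum (regularized X Z) n = ∑ i ∈ Finset.range n, regularized X Z i := by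
    funext ω
    simp [partialSum]
  rw [e, h]
  simp only [hw.variance_Y, Finset.sum_const, Finset.card_range, nsmul_eq_mul]

theorem covariance_Y_S (hw : NoisyWalk P X Z δ) {n : ℕ} (hn : 0 < n) :
    cov[regularized X Z 0, partialSum (regularized X Z) n; P] =
      variance (regularized X Z 0) P := by
  have h := covariance_fun_sum_right' (s := Finset.range n) (fun i _ => hw.memLp_Y i)
    (hw.memLp_Y 0)
  refine h.trans ?_
  rw [Finset.sum_eq_single_of_mem 0 (Finset.mem_range.2 hn) fun i _ hi =>
    (hw.indepFun_Y hi.symm).covariance_eq_zero (hw.memLp_Y 0) (hw.memLp_Y i)]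
  exact covariance_self (hw.measurable_Y 0).aemeasurable

/-! ### The moment generating function of `(Y 0 - X 1)²` -/

theorem integral_sq_Y_sub_X (hw : NoisyWalk P X Z δ) :
    ∫ ω, (regularized X Z 0 ω - X 1 ω) ^ 2 ∂P = 2 * variance (X 0) P + δ ^ 2 := by
  have hYm := hw.memLp_Y 0
  have hXm := hw.memLp_X 1
  have hmean : ∫ ω, (regularized X Z 0 - X 1) ω ∂P = 0 := by
    have e1 : ∫ ω, regularized X Z 0 ω ∂P = ∫ ω, X 0 ω ∂P := by
      have := integral_add ((hw.memLp_X 0).integrable one_le_two)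
        ((hw.memLp_Z 0).integrable one_le_two)
      rw [hw.integral_Z, add_zero] at this
      exact this
    have e2 := integral_sub (hYm.integrable one_le_two) (hXm.integrable one_le_two)
    rw [e1, (hw.ident 1).integral_eq, sub_self] at e2
    exact e2
  have h1 := variance_eq_sub (hYm.sub hXm)
  rw [hmean, variance_sub hYm hXm, hw.indepFun_Y_X.covariance_eq_zero hYm hXm, hw.variance_Y,
    (hw.ident 1).variance_eq] at h1
  have h2 : ∫ ω, (regularized X Z 0 ω - X 1 ω) ^ 2 ∂P =
      ∫ ω, ((regularized X Z 0 - X 1) ^ 2) ω ∂P := rfl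
  rw [h2]
  linarith

/-- The bound for the squared Hilbert–Schmidt norm of the conditional expectation operator for
`S (m + 1)`. -/
noncomputable def hsBound (P : Measure Ω) (X Z : ℕ → Ω → ℝ) (δ : ℝ) (m : ℕ) : ℝ :=
  (m + 1) / √(m * (m + 2)) *
    mgf (fun ω => (regularized X Z 0 ω - X 1 ω) ^ 2) P (1 / ((m + 2) * δ ^ 2))

theorem tendsto_hsParam (hδ : 0 < δ) :
    Tendsto (fun m : ℕ => 1 / (((m : ℝ) + 2) * δ ^ 2)) atTop (𝓝 0) := by
  have h1 : Tendsto (fun m : ℕ => ((m : ℝ) + 2) * δ ^ 2) atTop atTop :=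
    (tendsto_atTop_add_const_right _ _ tendsto_natCast_atTop_atTop).atTop_mul_const
      (sq_pos_of_pos hδ)
  simp only [one_div]
  exact h1.inv_tendsto_atTop

theorem eventually_hilbertSchmidtLE (hw : NoisyWalk P X Z δ) :
    ∀ᶠ m : ℕ in atTop, HilbertSchmidtLE
      (condExpOp P (hw.measurable_Y 0) (hw.measurable_S (m + 1))) (hsBound P X Z δ m) := by
  have h0 := mem_interior_iff_mem_nhds.1 hw.zero_mem_interior_integrableExpSet
  filter_upwards [(tendsto_hsParam hw.pos).eventually h0, eventually_gt_atTop 0] with m hm hm0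
  have hint : Integrable (fun ω => Real.exp (1 / ((m + 2) * δ ^ 2) *
      (regularized X Z 0 ω - X 1 ω) ^ 2)) P := hm
  set M : ℝ≥0∞ := ENNReal.ofReal ((m + 1) / √(m * (m + 2))) *
    ∫⁻ ω, ENNReal.ofReal (Real.exp ((regularized X Z 0 ω - X 1 ω) ^ 2 / ((m + 2) * δ ^ 2))) ∂P
    with hM
  have hMeq : M = ENNReal.ofReal (hsBound P X Z δ m) := by
    rw [hsBound, ENNReal.ofReal_mul (by positivity), mgf,
      ofReal_integral_eq_lintegral_ofReal hint (Eventually.of_forall fun ω => (Real.exp_pos _).le)]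
    have e : ∀ ω, 1 / ((m + 2) * δ ^ 2) * (regularized X Z 0 ω - X 1 ω) ^ 2 =
        (regularized X Z 0 ω - X 1 ω) ^ 2 / ((m + 2) * δ ^ 2) := fun ω => by ring
    simp only [hM, e]
  have h := hilbertSchmidtLE_condExpOp (M := M) (hw.measurable_Y 0) (hw.measurable_S (m + 1))
    (by rw [hMeq]; exact ENNReal.ofReal_ne_top) fun G hG => hw.two_mul_lintegral_le hm0 hG
  have hnn : 0 ≤ hsBound P X Z δ m := mul_nonneg (by positivity) mgf_nonneg
  rwa [hMeq, ENNReal.toReal_ofReal hnn] at h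

/-- First-order expansion of the Hilbert–Schmidt bound:
`hsBound m = 1 + 1 / (m + 1) + (2 Var (X 0) / δ²) / (m + 1) + o(1 / m)`. -/
theorem tendsto_hsBound (hw : NoisyWalk P X Z δ) :
    Tendsto (fun m : ℕ => ((m : ℝ) + 1) * (hsBound P X Z δ m - 1 - 1 / ((m : ℝ) + 1))) atTop
      (𝓝 (2 * variance (X 0) P / δ ^ 2)) := by
  set D : Ω → ℝ := fun ω => (regularized X Z 0 ω - X 1 ω) ^ 2
  set r : ℕ → ℝ := fun m => 1 / (((m : ℝ) + 2) * δ ^ 2) with hr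
  set c : ℕ → ℝ := fun m => ((m : ℝ) + 1) / √(m * (m + 2)) with hc
  have hδ2 : 0 < δ ^ 2 := sq_pos_of_pos hw.pos
  have hr0 : Tendsto r atTop (𝓝 0) := tendsto_hsParam hw.pos
  have hrpos : ∀ m, 0 < r m := fun m => by positivity
  have hderiv : HasDerivAt (mgf D P) (2 * variance (X 0) P + δ ^ 2) 0 := by
    have h := hasDerivAt_mgf hw.zero_mem_interior_integrableExpSet
    simp only [zero_mul, Real.exp_zero, mul_one] at h
    rwa [hw.integral_sq_Y_sub_X] at h
  have hmgf0 : mgf D P 0 = 1 := by simp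
  have hM1 : Tendsto (fun m => mgf D P (r m)) atTop (𝓝 1) := by
    have h := hderiv.continuousAt.tendsto.comp hr0
    rwa [hmgf0] at h
  have hslope : Tendsto (fun m => (r m)⁻¹ * (mgf D P (r m) - 1)) atTop
      (𝓝 (2 * variance (X 0) P + δ ^ 2)) := by
    have h1 : Tendsto r atTop (𝓝[≠] 0) :=
      tendsto_nhdsWithin_iff.2 ⟨hr0, Eventually.of_forall fun m => (hrpos m).ne'⟩
    have h2 := (hasDerivAt_iff_tendsto_slope.1 hderiv).comp h1
    refine h2.congr fun m => ?_
    simp [slope_def_field, hmgf0, div_eq_inv_mul]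
  have hnr : Tendsto (fun m : ℕ => ((m : ℝ) + 1) * r m) atTop (𝓝 (1 / δ ^ 2)) := by
    have h1 : Tendsto (fun m : ℕ => (1 : ℝ) / δ ^ 2 - r m) atTop (𝓝 (1 / δ ^ 2 - 0)) :=
      tendsto_const_nhds.sub hr0
    rw [sub_zero] at h1
    refine h1.congr fun m => ?_
    rw [hr]
    field_simp
    ring
  have hcerr : Tendsto (fun m : ℕ => ((m : ℝ) + 1) * (c m - 1)) atTop (𝓝 0) := by
    have hup : ∀ m : ℕ, 0 < m → 0 ≤ ((m : ℝ) + 1) * (c m - 1) ∧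
        ((m : ℝ) + 1) * (c m - 1) ≤ (m : ℝ)⁻¹ := by
      intro m hm
      have hm' : (0 : ℝ) < m := by exact_mod_cast hm
      have hpos : 0 < (m : ℝ) * (m + 2) := by positivity
      have hs : 0 < √((m : ℝ) * (m + 2)) := Real.sqrt_pos.2 hpos
      have hc1 : 1 ≤ c m := by
        rw [hc, one_le_div hs]
        exact Real.sqrt_le_iff.2 ⟨by positivity, by nlinarith⟩
      have hc2 : c m ^ 2 = 1 + 1 / (m * (m + 2)) := by
        rw [hc, div_pow, Real.sq_sqrt hpos.le]
        field_simp
        ring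
      refine ⟨mul_nonneg (by positivity) (by linarith), ?_⟩
      have hc3 : c m - 1 ≤ 1 / (m * (m + 2)) := by nlinarith
      calc ((m : ℝ) + 1) * (c m - 1) ≤ (m + 1) * (1 / (m * (m + 2))) := by gcongr
        _ ≤ (m : ℝ)⁻¹ := by
          rw [mul_one_div, div_le_iff₀ hpos]
          field_simp
          linarith
    refine tendsto_of_tendsto_of_tendsto_of_le_of_le' tendsto_const_nhds
      tendsto_inv_atTop_nhds_zero_nat ?_ ?_
    · filter_upwards [eventually_gt_atTop 0] with m hm using (hup m hm).1
    · filter_upwards [eventually_gt_atTop 0] with m hm using (hup m hm).2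
  have hsum := ((hcerr.mul hM1).add (hnr.mul hslope)).sub (tendsto_const_nhds (x := (1 : ℝ)))
  have hlim : 0 * 1 + 1 / δ ^ 2 * (2 * variance (X 0) P + δ ^ 2) - 1 =
      2 * variance (X 0) P / δ ^ 2 := by
    have := hδ2.ne'
    rw [zero_mul, zero_add, one_div, mul_add, inv_mul_cancel₀ this]
    ring
  rw [hlim] at hsum
  refine hsum.congr fun m => ?_
  have hrm := (hrpos m).ne'
  have hm1 : ((m : ℝ) + 1) ≠ 0 := by positivity
  have e1 : hsBound P X Z δ m = c m * mgf D P (r m) := rfl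
  rw [e1]
  have e2 : ((m : ℝ) + 1) * r m * ((r m)⁻¹ * (mgf D P (r m) - 1)) =
      ((m : ℝ) + 1) * (mgf D P (r m) - 1) := by
    field_simp
  rw [e2]
  have e3 : ((m : ℝ) + 1) * (1 / ((m : ℝ) + 1)) = 1 := by field_simp
  linear_combination e3

/-! ### Injectivity of the conditional expectation operator -/

/-- Conditioning `f (Y 0)` on `S (m + 1)` loses nothing: testing against `exp (t S)` and dividing
by the positive number `E exp (t (S - Y 0))` gives the Laplace transform of `f` under the law of
`Y 0`. -/
theorem injective_condExpOp (hw : NoisyWalk P X Z δ) (m : ℕ) :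
    Function.Injective (condExpOp P (hw.measurable_Y 0) (hw.measurable_S (m + 1))) := by
  rw [injective_iff_map_eq_zero]
  intro f hf
  have hYm := hw.measurable_Y 0
  have hSm := hw.measurable_S (m + 1)
  have : IsProbabilityMeasure (P.map (regularized X Z 0)) :=
    Measure.isProbabilityMeasure_map hYm.aemeasurable
  have hfm : Measurable f := (Lp.stronglyMeasurable f).measurable
  set R : Ω → ℝ := fun ω => ∑ i ∈ Finset.Ico 1 (m + 1), regularized X Z i ω
  have hRm : Measurable R := Finset.measurable_sum _ fun i _ => hw.measurable_Y i
  have hS : ∀ ω, partialSum (regularized X Z) (m + 1) ω = regularized X Z 0 ω + R ω := fun ω => by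
    rw [partialSum, Finset.range_eq_Ico, Finset.sum_eq_sum_Ico_succ_bot (Nat.succ_pos m)]
  have hind : IndepFun (regularized X Z 0) R P := by
    refine hw.indepFun_of_disjoint (s := {Sum.inl 0, Sum.inr 0})
      (t := Sum.inl '' Set.Ici 1 ∪ Sum.inr '' Set.Ici 1) ?_
      ((measurable_generatedBy_inl X Z (by simp)).add (measurable_generatedBy_inr X Z (by simp)))
      (Finset.measurable_sum _ fun j hj => by
        have hj1 := (Finset.mem_Ico.1 hj).1
        exact (measurable_generatedBy_inl X Z (Or.inl ⟨j, hj1, rfl⟩)).add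
          (measurable_generatedBy_inr X Z (Or.inr ⟨j, hj1, rfl⟩)))
    rw [Set.disjoint_left]
    rintro _ (rfl | rfl) <;> simp
  have hYexp : ∀ t : ℝ, MemLp (fun y => Real.exp (t * y)) 2 (P.map (regularized X Z 0)) := by
    intro t
    refine (memLp_two_iff_integrable_sq (by fun_prop)).2 ?_
    refine (integrable_map_measure (by fun_prop) hYm.aemeasurable).2 ?_
    refine (hw.integrable_exp_mul_S 1 (2 * t)).congr (Eventually.of_forall fun ω => ?_)
    simp only [partialSum, Finset.sum_range_one, Function.comp_apply]
    rw [← Real.exp_nat_mul]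
    congr 1
    push_cast
    ring
  have hSexp : ∀ t : ℝ, MemLp (fun s => Real.exp (t * s)) 2
      (P.map (partialSum (regularized X Z) (m + 1))) := by
    intro t
    refine (memLp_two_iff_integrable_sq (by fun_prop)).2 ?_
    refine (integrable_map_measure (by fun_prop) hSm.aemeasurable).2 ?_
    refine (hw.integrable_exp_mul_S (m + 1) (2 * t)).congr (Eventually.of_forall fun ω => ?_)
    simp only [Function.comp_apply]
    rw [← Real.exp_nat_mul]
    congr 1
    push_cast
    ring
  have key : ∀ t : ℝ, ∫ y, f y * Real.exp (t * y) ∂(P.map (regularized X Z 0)) = 0 := by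
    intro t
    have h1 : ∫ ω, f (regularized X Z 0 ω) * ((hSexp t).toLp _)
        (partialSum (regularized X Z) (m + 1) ω) ∂P = 0 := by
      rw [← inner_condExpOp hYm hSm, hf, inner_zero_left]
    have h2 : (fun ω => ((hSexp t).toLp _) (partialSum (regularized X Z) (m + 1) ω)) =ᵐ[P]
        fun ω => Real.exp (t * partialSum (regularized X Z) (m + 1) ω) :=
      (hSm.measurePreserving P).quasiMeasurePreserving.ae_eq_comp (hSexp t).coeFn_toLp
    have h3 : ∫ ω, (f (regularized X Z 0 ω) * Real.exp (t * regularized X Z 0 ω)) *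
        Real.exp (t * R ω) ∂P = 0 := by
      rw [← h1]
      refine integral_congr_ae ?_
      filter_upwards [h2] with ω hω
      rw [hω, hS, mul_add, Real.exp_add]
      ring
    have hind2 : IndepFun (fun ω => f (regularized X Z 0 ω) * Real.exp (t * regularized X Z 0 ω))
        (fun ω => Real.exp (t * R ω)) P :=
      hind.comp (φ := fun y => f y * Real.exp (t * y)) (ψ := fun x => Real.exp (t * x))
        (by fun_prop) (by fun_prop)
    rw [hind2.integral_fun_mul_eq_mul_integral (by fun_prop) (by fun_prop)] at h3
    have hRpos : 0 < ∫ ω, Real.exp (t * R ω) ∂P := by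
      refine mgf_pos (X := R) (t := t) ?_
      -- `exp (t R)` is the product of the square-integrable `exp (t S)` and `exp (-t Y 0)`
      have i1 := ((hSexp t).comp_measurePreserving (hSm.measurePreserving P)).integrable_mul
        ((hYexp (-t)).comp_measurePreserving (hYm.measurePreserving P))
      refine i1.congr (Eventually.of_forall fun ω => ?_)
      simp only [Pi.mul_apply, Function.comp_apply]
      rw [← Real.exp_add, hS]
      congr 1
      ring
    rw [integral_map hYm.aemeasurable (by fun_prop)]
    exact (mul_eq_zero.1 h3).resolve_right hRpos.ne'
  have h0 := ae_eq_zero_of_forall_integral_mul_exp_eq_zero hfm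
    (fun t => (Lp.memLp f).integrable_mul (hYexp t)) key
  exact (Lp.eq_zero_iff_ae_eq_zero).2 h0

theorem not_finiteDimensional (hw : NoisyWalk P X Z δ) :
    ¬ FiniteDimensional ℝ (Lp ℝ 2 (P.map (regularized X Z 0))) := by
  have : IsProbabilityMeasure (P.map (regularized X Z 0)) :=
    Measure.isProbabilityMeasure_map (hw.measurable_Y 0).aemeasurable
  refine not_finiteDimensional_Lp_two fun k => ?_
  have hv := hw.toNNReal_pos.ne'
  set I := Set.Ico (k : ℝ) (k + 1) with hI
  have hIm : MeasurableSet I := measurableSet_Ico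
  have hg : Measurable (I.indicator (1 : ℝ → ℝ≥0∞)) := measurable_one.indicator hIm
  have h1 := lintegral_add_gaussian (F := fun z : ℝ × ℝ => I.indicator 1 z.2)
    (hw.measurable_X 0) (hw.measurable_Z 0) (hw.indepFun_X_Z 0 0) hv (hw.gauss 0) measurable_id
    (hg.comp measurable_snd)
  have h2 : P.map (regularized X Z 0) I =
      ∫⁻ ω, I.indicator 1 (id (X 0 ω) + Z 0 ω) ∂P := by
    rw [← lintegral_indicator_one hIm, lintegral_map hg (hw.measurable_Y 0)]
    rfl
  rw [h2, h1]
  have : IsProbabilityMeasure (P.map (X 0)) :=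
    Measure.isProbabilityMeasure_map (hw.measurable_X 0).aemeasurable
  have hm : Measurable fun x : ℝ => ∫⁻ s, I.indicator 1 s *
      gaussianPDF (id x) (Real.toNNReal (δ ^ 2)) s :=
    measurable_lintegral_mul_gaussianPDF (F := fun z : ℝ × ℝ => I.indicator 1 z.2) measurable_id
      (hg.comp measurable_snd)
  have hpos : ∀ x : ℝ, 0 < ∫⁻ s, I.indicator 1 s *
      gaussianPDF (id x) (Real.toNNReal (δ ^ 2)) s := by
    intro x
    have hgx : Measurable fun s => I.indicator 1 s *
        gaussianPDF (id x) (Real.toNNReal (δ ^ 2)) s := hg.mul (measurable_gaussianPDF _ _)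
    rw [lintegral_pos_iff_support hgx]
    have hsub : I ⊆ Function.support fun s => I.indicator 1 s *
        gaussianPDF (id x) (Real.toNNReal (δ ^ 2)) s := by
      intro s hs
      simp [hs, (gaussianPDF_pos x hv s).ne']
    refine lt_of_lt_of_le ?_ (measure_mono hsub)
    simp [hI]
  rw [lintegral_pos_iff_support hm]
  have : (Function.support fun x : ℝ => ∫⁻ s, I.indicator 1 s *
      gaussianPDF (id x) (Real.toNNReal (δ ^ 2)) s) = Set.univ :=
    Set.eq_univ_of_forall fun x => (hpos x).ne'
  rw [this]
  simp

end NoisyWalk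

/-! ### Test functions for the two top eigenvalues -/

section Standardize

variable {Ω : Type*} [MeasurableSpace Ω] {P : Measure Ω} [IsProbabilityMeasure P] {U : Ω → ℝ}

/-- The standardization of `U`, as a unit vector of `L²(ℙ_U)` orthogonal to the constants. -/
theorem exists_standardized (hU : Measurable U) (hU2 : MemLp U 2 P) (hvar : 0 < variance U P) :
    ∃ u : Lp ℝ 2 (P.map U), ‖u‖ = 1 ∧ inner ℝ (Lp.const 2 (P.map U) (1 : ℝ)) u = 0 ∧
      (fun ω => u (U ω)) =ᵐ[P] fun ω => (U ω - P[U]) / √(variance U P) := by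
  have : IsProbabilityMeasure (P.map U) := Measure.isProbabilityMeasure_map hU.aemeasurable
  have hL : MemLp (fun y => (y - P[U]) / √(variance U P)) 2 (P.map U) := by
    refine (memLp_map_measure_iff (by fun_prop) hU.aemeasurable).2 ?_
    have h := (hU2.sub (memLp_const (P[U]))).const_mul (√(variance U P))⁻¹
    refine MemLp.ae_eq (Eventually.of_forall fun ω => ?_) h
    simp only [Pi.sub_apply, Function.comp_apply]
    rw [div_eq_inv_mul]
  have hae := hL.coeFn_toLp
  refine ⟨hL.toLp _, ?_, ?_, ?_⟩
  · have h1 : ‖hL.toLp _‖ ^ 2 = 1 := by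
      rw [← real_inner_self_eq_norm_sq, L2.inner_def]
      have h2 : ∫ y, inner ℝ (hL.toLp _ y) (hL.toLp _ y) ∂(P.map U) =
          ∫ y, ((y - P[U]) / √(variance U P)) ^ 2 ∂(P.map U) := by
        refine integral_congr_ae ?_
        filter_upwards [hae] with y hy
        rw [hy, real_inner_self_eq_norm_sq, Real.norm_eq_abs, sq_abs]
      rw [h2, integral_map hU.aemeasurable (by fun_prop)]
      simp only [div_pow, Real.sq_sqrt hvar.le]
      rw [integral_div, ← variance_eq_integral hU.aemeasurable, div_self hvar.ne']
    exact (pow_eq_one_iff_of_nonneg (norm_nonneg _) two_ne_zero).1 h1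
  · rw [L2.inner_def]
    have h2 : ∫ y, inner ℝ (Lp.const 2 (P.map U) (1 : ℝ) y) (hL.toLp _ y) ∂(P.map U) =
        ∫ y, (y - P[U]) / √(variance U P) ∂(P.map U) := by
      refine integral_congr_ae ?_
      filter_upwards [hae, Lp.coeFn_const (p := 2) (μ := P.map U) (c := (1 : ℝ))] with y hy hc
      rw [hy, hc]
      simp
    rw [h2, integral_map hU.aemeasurable (by fun_prop), integral_div,
      integral_sub (hU2.integrable one_le_two) (integrable_const _)]
    simp
  · exact (hU.measurePreserving P).quasiMeasurePreserving.ae_eq_comp hae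

theorem norm_Lp_const_one {μ : Measure ℝ} [IsProbabilityMeasure μ] :
    ‖Lp.const 2 μ (1 : ℝ)‖ = 1 := by
  have h := Lp.norm_const' (p := 2) (μ := μ) (c := (1 : ℝ)) (by norm_num) (by norm_num)
  simpa using h

theorem one_le_norm_sq_condExpOp_const {V : Ω → ℝ} (hU : Measurable U) (hV : Measurable V) :
    1 ≤ ‖condExpOp P hU hV (Lp.const 2 (P.map U) (1 : ℝ))‖ ^ 2 := by
  have : IsProbabilityMeasure (P.map V) := Measure.isProbabilityMeasure_map hV.aemeasurable
  have h := sq_integral_le_norm_sq_condExpOp hU hV (Lp.const 2 (P.map U) (1 : ℝ))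
    (Lp.const 2 (P.map V) (1 : ℝ)) norm_Lp_const_one
  have h1 := (hU.measurePreserving P).quasiMeasurePreserving.ae_eq_comp
    (Lp.coeFn_const (p := 2) (μ := P.map U) (c := (1 : ℝ)))
  have h2 := (hV.measurePreserving P).quasiMeasurePreserving.ae_eq_comp
    (Lp.coeFn_const (p := 2) (μ := P.map V) (c := (1 : ℝ)))
  have h3 : ∫ ω, (Lp.const 2 (P.map U) (1 : ℝ)) (U ω) * (Lp.const 2 (P.map V) (1 : ℝ)) (V ω) ∂P
      = 1 := by
    have h4 : ∫ ω, (Lp.const 2 (P.map U) (1 : ℝ)) (U ω) * (Lp.const 2 (P.map V) (1 : ℝ)) (V ω) ∂P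
        = ∫ _, (1 : ℝ) ∂P := by
      refine integral_congr_ae ?_
      filter_upwards [h1, h2] with ω e1 e2
      simp only [Function.comp_apply, Function.const_apply] at e1 e2
      rw [e1, e2, one_mul]
    rw [h4]
    simp
  rwa [h3, one_pow] at h

end Standardize

namespace NoisyWalk

variable {Ω : Type*} [MeasurableSpace Ω] {P : Measure Ω} [IsProbabilityMeasure P]
  {X Z : ℕ → Ω → ℝ} {δ : ℝ}

/-- The correlation of `Y 0` and `S n` is `1 / √n`, which makes `1 / n` a lower bound for the
quadratic form of `C* C` at the standardization of `Y 0`. -/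
theorem exists_test_vector (hw : NoisyWalk P X Z δ) {n : ℕ} (hn : 0 < n) :
    ∃ u : Lp ℝ 2 (P.map (regularized X Z 0)), ‖u‖ = 1 ∧
      inner ℝ (Lp.const 2 (P.map (regularized X Z 0)) (1 : ℝ)) u = 0 ∧
      1 / (n : ℝ) ≤ ‖condExpOp P (hw.measurable_Y 0) (hw.measurable_S n) u‖ ^ 2 := by
  have hn' : (0 : ℝ) < n := by exact_mod_cast hn
  have hY := hw.variance_Y_pos 0
  have hS : 0 < variance (partialSum (regularized X Z) n) P := by
    rw [hw.variance_S]
    positivity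
  obtain ⟨u, hu1, hu0, hu⟩ := exists_standardized (hw.measurable_Y 0) (hw.memLp_Y 0) hY
  obtain ⟨v, hv1, -, hv⟩ := exists_standardized (hw.measurable_S n) (hw.memLp_S n) hS
  refine ⟨u, hu1, hu0, ?_⟩
  refine le_trans (le_of_eq ?_) (sq_integral_le_norm_sq_condExpOp (hw.measurable_Y 0)
    (hw.measurable_S n) u v hv1)
  have h1 : ∫ ω, u (regularized X Z 0 ω) * v (partialSum (regularized X Z) n ω) ∂P =
      cov[regularized X Z 0, partialSum (regularized X Z) n; P] /
        (√(variance (regularized X Z 0) P) *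
          √(variance (partialSum (regularized X Z) n) P)) := by
    rw [covariance, ← integral_div]
    refine integral_congr_ae ?_
    filter_upwards [hu, hv] with ω e1 e2
    rw [e1, e2, div_mul_div_comm]
  rw [h1, hw.covariance_Y_S hn, div_pow, mul_pow, Real.sq_sqrt hY.le, Real.sq_sqrt hS.le,
    hw.variance_S]
  field_simp

/-- The spectral tail beyond the two leading eigenvalues is at most what remains of the
Hilbert–Schmidt bound. -/
theorem tsum_tail_le (hw : NoisyWalk P X Z δ) {m : ℕ} {lam : ℕ → ℝ} {M : ℝ}
    (hHS : HilbertSchmidtLE (condExpOp P (hw.measurable_Y 0) (hw.measurable_S (m + 1))) M)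
    (h : IsEigenvalueSeq (condExpGram P (hw.measurable_Y 0) (hw.measurable_S (m + 1))) lam) :
    ∑' k, lam (k + 2) ≤ M - 1 - 1 / ((m : ℝ) + 1) := by
  have : IsProbabilityMeasure (P.map (regularized X Z 0)) :=
    Measure.isProbabilityMeasure_map (hw.measurable_Y 0).aemeasurable
  obtain ⟨u, hu1, hu0, hu⟩ := hw.exists_test_vector (n := m + 1) (Nat.succ_pos m)
  have h1 := IsEigenvalueSeq.tsum_tail_le h hHS norm_Lp_const_one hu1 hu0
  have h2 := one_le_norm_sq_condExpOp_const (P := P) (hw.measurable_Y 0) (hw.measurable_S (m + 1))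
  push_cast at hu
  linarith

end NoisyWalk

theorem mainTheorem8 {Ω : Type*} [MeasurableSpace Ω] (P : Measure Ω) [IsProbabilityMeasure P]
    (X Z : ℕ → Ω → ℝ) (hX : ∀ i, Measurable (X i)) (hZ : ∀ i, Measurable (Z i))
    (δ : ℝ) (hδ : 0 < δ)
    (hindep : iIndepFun (fun j : ℕ ⊕ ℕ => Sum.elim X Z j) P)
    (hident : ∀ i, IdentDistrib (X i) (X 0) P P)
    (hsub : IsSubGaussian (X 0) P)
    (hgauss : ∀ i, P.map (Z i) = gaussianReal 0 (Real.toNNReal (δ ^ 2))) :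
    -- for all large `n` the operator is diagonalizable, with ordered eigenvalues
    (∀ᶠ n : ℕ in atTop, ∃ lam : ℕ → ℝ,
      IsEigenvalueSeq
        (condExpGram P (measurable_regularized hX hZ 0)
          (measurable_partialSum (measurable_regularized hX hZ) n)) lam) ∧
    ∀ lam : ℕ → ℕ → ℝ,
      (∀ᶠ n : ℕ in atTop,
        IsEigenvalueSeq
          (condExpGram P (measurable_regularized hX hZ 0)
            (measurable_partialSum (measurable_regularized hX hZ) n)) (lam n)) →
      (∀ᶠ n : ℕ in atTop, Summable (lam n)) ∧
      limsup (fun n : ℕ => ((n * lam n 2 : ℝ) : EReal)) atTop ≤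
        limsup (fun n : ℕ => ((n * ∑' k : ℕ, lam n (k + 2) : ℝ) : EReal)) atTop ∧
      limsup (fun n : ℕ => ((n * ∑' k : ℕ, lam n (k + 2) : ℝ) : EReal)) atTop ≤
        ((2 * variance (X 0) P / δ ^ 2 : ℝ) : EReal) ∧
      (2 * variance (X 0) P < δ ^ 2 → ∀ᶠ n : ℕ in atTop, 0 < theta n (lam n)) := by
  have hw : NoisyWalk P X Z δ := ⟨hX, hZ, hδ, hindep, hident, hsub, hgauss⟩
  have hHS : ∀ᶠ n : ℕ in atTop, HilbertSchmidtLE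
      (condExpOp P (hw.measurable_Y 0) (hw.measurable_S n)) (NoisyWalk.hsBound P X Z δ (n - 1)) := by
    filter_upwards [(tendsto_sub_atTop_nat 1).eventually hw.eventually_hilbertSchmidtLE,
      eventually_ge_atTop 1] with n hn hn1
    obtain ⟨m, rfl⟩ := Nat.exists_eq_add_of_le' hn1
    exact hn
  have hinj : ∀ᶠ n : ℕ in atTop, Function.Injective
      (condExpOp P (hw.measurable_Y 0) (hw.measurable_S n)) := by
    filter_upwards [eventually_ge_atTop 1] with n hn1
    obtain ⟨m, rfl⟩ := Nat.exists_eq_add_of_le' hn1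
    exact hw.injective_condExpOp m
  refine ⟨?_, fun lam hlam => ?_⟩
  · filter_upwards [hHS, hinj] with n h1 h2
    exact h1.exists_isEigenvalueSeq h2 hw.not_finiteDimensional
  have hsum : ∀ᶠ n : ℕ in atTop, Summable (lam n) := by
    filter_upwards [hHS, hlam] with n h1 h2 using IsEigenvalueSeq.summable h2 h1
  have hnonneg : ∀ᶠ n : ℕ in atTop, ∀ k, 0 ≤ lam n k := by
    filter_upwards [hlam] with n h2 using IsEigenvalueSeq.nonneg h2
  have hle2 : ∀ᶠ n : ℕ in atTop, n * lam n 2 ≤ n * ∑' k : ℕ, lam n (k + 2) := by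
    filter_upwards [hsum, hnonneg] with n h1 h2
    have h3 := ((summable_nat_add_iff 2).2 h1).le_tsum 0 fun k _ => h2 (k + 2)
    gcongr
  set B : ℕ → ℝ := fun n => n * (NoisyWalk.hsBound P X Z δ (n - 1) - 1 - 1 / (n : ℝ)) with hB
  have hBlim : Tendsto B atTop (𝓝 (2 * variance (X 0) P / δ ^ 2)) := by
    refine (tendsto_add_atTop_iff_nat 1).1 (hw.tendsto_hsBound.congr fun m => ?_)
    simp [hB]
  have htail : ∀ᶠ n : ℕ in atTop, n * ∑' k : ℕ, lam n (k + 2) ≤ B n := by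
    filter_upwards [hHS, hlam, eventually_ge_atTop 1] with n h1 h2 hn1
    obtain ⟨m, rfl⟩ := Nat.exists_eq_add_of_le' hn1
    have h3 := hw.tsum_tail_le h1 h2
    rw [hB]
    simp only [Nat.add_sub_cancel] at h3
    simp only [Nat.add_sub_cancel]
    push_cast
    gcongr
  refine ⟨hsum, ?_, ?_, ?_⟩
  · refine limsup_le_limsup ?_
    filter_upwards [hle2] with n hn using EReal.coe_le_coe_iff.2 hn
  · have h1 : Tendsto (fun n => (B n : EReal)) atTop
        (𝓝 ((2 * variance (X 0) P / δ ^ 2 : ℝ) : EReal)) := EReal.tendsto_coe.2 hBlim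
    rw [← h1.limsup_eq]
    refine limsup_le_limsup ?_
    filter_upwards [htail] with n hn using EReal.coe_le_coe_iff.2 hn
  · intro hlt
    have hlt1 : 2 * variance (X 0) P / δ ^ 2 < 1 := (div_lt_one (sq_pos_of_pos hδ)).2 hlt
    filter_upwards [hBlim.eventually_lt_const hlt1, hle2, htail, hlam, hinj,
      eventually_gt_atTop 0] with n h1 h2 h3 h4 h5 hn
    have hpos : 0 < n * lam n 2 :=
      mul_pos (by exact_mod_cast hn) (IsEigenvalueSeq.pos h4 h5 2)
    rw [theta, sub_pos, one_lt_div hpos]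
    linarith
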